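/- Let $K$ be a field of characteristic $0$ (for instance $K=\mathbb{C}$), and let $\tau_l=\tau_l(t)$, $l\in\mathbb{Z}$, be a sequence of non-zero formal power series over $K$ in the infinitely many variables $t=(t_1,t_2,t_3,\dots)$. Put $$[\alpha]=\left(\alpha,\frac{\alpha^2}{2},\frac{\alpha^3}{3},\dots\right),\qquad \xi(t,\lambda)=\sum_{n=1}^{\infty}t_n\lambda^n,\qquad \alpha_{ij}=\alpha_i-\alpha_j,$$ and let $\oint\frac{d\lambda}{2\pi i}$ denote the formal operator that extracts the coefficient of $\lambda^{-1}$ from a Laurent series in $\lambda$. Then the following two systems of equations for $(\tau_l)_{l\in\mathbb{Z}}$ are equivalent. (a) The three term equations of the mKP hierarchy: for all $l\in\mathbb{Z}$, $$\alpha_{23}\,\tau_l(x+[\alpha_1])\,\tau_{l+1}(x+[\alpha_2]+[\alpha_3])-\alpha_{13}\,\tau_l(x+[\alpha_2])\,\tau_{l+1}(x+[\alpha_1]+[\alpha_3])+\alpha_{12}\,\tau_l(x+[\alpha_3])\,\tau_{l+1}(x+[\alpha_1]+[\alpha_2])=0,$$ as an identity of formal power series in $x=(x_1,x_2,\dots)$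 and $\alpha_1,\alpha_2,\alpha_3$. (b) The mKP hierarchy: for all $l,l'\in\mathbb{Z}$ with $l\ge l'$, $$\oint e^{\xi(t'-t,\lambda)}\,\lambda^{l-l'}\,\tau_l\big(t'-[\lambda^{-1}]\big)\,\tau_{l'}\big(t+[\lambda^{-1}]\big)\frac{d\lambda}{2\pi i}=0,$$ as an identity of formal power series in $t=(t_1,t_2,\dots)$ and $t'=(t'_1,t'_2,\dots)$. -/

import Mathlib

noncomputable section

namespace MKP

open MvPowerSeries

set_option linter.unusedSectionVars false

variable {K : Type*} [Field K] [CharZero K]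

/-- Formal power series over `K` in the infinitely many times `t₁, t₂, t₃, …`. -/
abbrev TimeSeries (K : Type*) := MvPowerSeries ℕ+ K

/-- `[α] = (α, α² / 2, α³ / 3, …)`. -/
def bracket {σ : Type*} (α : MvPowerSeries σ K) : ℕ+ → MvPowerSeries σ K :=
  fun n => ((n : ℕ) : K)⁻¹ • α ^ (n : ℕ)

/-- The value `τ(a) = τ(a₁, a₂, …)` of a formal power series `τ` at a sequence `a` of formal
power series in other variables (substitution of `aₙ` for `tₙ`). -/
abbrev evalAt {σ : Type*} (τ : TimeSeries K) (a : ℕ+ → MvPowerSeries σ K) : MvPowerSeries σ K :=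
  MvPowerSeries.subst a τ

/-- The two indeterminates that stand for `λ` and for `λ⁻¹`. -/
inductive Spectral
  | lam
  | lamInv

/-- The coefficientwise sum of a locally finite family of formal power series. -/
def formalSum {ι σ : Type*} (f : ι → MvPowerSeries σ K) : MvPowerSeries σ K :=
  fun m => ∑ᶠ i, coeff m (f i)

/-- The monomial `s · λᵃ · (λ⁻¹)ᵇ`, for a monomial `s` in the variables `σ`. -/
def spectralMonomial {σ : Type*} (s : σ →₀ ℕ) (a b : ℕ) : σ ⊕ Spectral →₀ ℕ :=
  s.embDomain Function.Embedding.inl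
    + Finsupp.single (Sum.inr Spectral.lam) a + Finsupp.single (Sum.inr Spectral.lamInv) b

/-- The formal operator `∮ dλ / (2πi)`: for a series `F(λ, λ⁻¹) = ∑ F_{ab} λᵃ (λ⁻¹)ᵇ` it extracts
the coefficient of `λ⁻¹`, that is the sum of all `F_{ab}` with `a - b = -1`. -/
def residue {σ : Type*} (F : MvPowerSeries (σ ⊕ Spectral) K) : MvPowerSeries σ K :=
  fun s => ∑ᶠ a : ℕ, coeff (spectralMonomial s a (a + 1)) F

/-- The ring of the bilinear equation: formal power series in `t = (tₙ)`, `t' = (t'ₙ)`, and the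
indeterminates that stand for `λ` and `λ⁻¹`. -/
abbrev BilinearRing (K : Type*) := MvPowerSeries ((ℕ+ ⊕ ℕ+) ⊕ Spectral) K

/-- The variables `tₙ`. -/
def tvar : ℕ+ → BilinearRing K := fun n => X (Sum.inl (Sum.inl n))

/-- The variables `t'ₙ`. -/
def tvar' : ℕ+ → BilinearRing K := fun n => X (Sum.inl (Sum.inr n))

/-- `λ`. -/
def lam : BilinearRing K := X (Sum.inr Spectral.lam)

/-- `λ⁻¹`. -/
def lamInv : BilinearRing K := X (Sum.inr Spectral.lamInv)

/-- `ξ(a, λ) = ∑_{n ≥ 1} aₙ λⁿ`. -/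
def xi (a : ℕ+ → BilinearRing K) : BilinearRing K :=
  formalSum fun n : ℕ+ => a n * lam ^ (n : ℕ)

/-- `e^f`, for a formal power series `f` without constant term. -/
def formalExp {σ : Type*} (f : MvPowerSeries σ K) : MvPowerSeries σ K :=
  (PowerSeries.exp K).subst f

/-- The integrand `e^{ξ(t'-t,λ)} λᵏ τ(t' - [λ⁻¹]) ρ(t + [λ⁻¹])`. -/
def integrand (k : ℕ) (τ ρ : TimeSeries K) : BilinearRing K :=
  formalExp (xi (tvar' - tvar)) * lam ^ k
    * evalAt τ (tvar' - bracket lamInv) * evalAt ρ (tvar + bracket lamInv)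

/-- The modified KP hierarchy:
`∮ e^{ξ(t'-t,λ)} λ^{l-l'} τ_l(t' - [λ⁻¹]) τ_{l'}(t + [λ⁻¹]) dλ / (2πi) = 0` for all `l ≥ l'`. -/
def MKPHierarchy (τ : ℤ → TimeSeries K) : Prop :=
  ∀ l l' : ℤ, l' ≤ l → residue (integrand (l - l').toNat (τ l) (τ l')) = 0

/-- The ring of the three term equation: formal power series in `x = (xₙ)` and `α₁, α₂, α₃`. -/
abbrev ThreeTermRing (K : Type*) := MvPowerSeries (ℕ+ ⊕ Fin 3) K

/-- The variables `xₙ`. -/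
def xvar : ℕ+ → ThreeTermRing K := fun n => X (Sum.inl n)

/-- The indeterminates `α₁, α₂, α₃` (numbered from `0`). -/
def alpha (i : Fin 3) : ThreeTermRing K := X (Sum.inr i)

/-- The three term equation of the mKP hierarchy, for every `l`:
`α₂₃ τ_l(x+[α₁]) τ_{l+1}(x+[α₂]+[α₃]) - α₁₃ τ_l(x+[α₂]) τ_{l+1}(x+[α₁]+[α₃])
  + α₁₂ τ_l(x+[α₃]) τ_{l+1}(x+[α₁]+[α₂]) = 0`, where `αᵢⱼ = αᵢ - αⱼ`. -/
def ThreeTermEquation (τ : ℤ → TimeSeries K) : Prop :=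
  ∀ l : ℤ,
    (alpha 1 - alpha 2) * evalAt (τ l) (xvar + bracket (alpha 0))
        * evalAt (τ (l + 1)) (xvar + bracket (alpha 1) + bracket (alpha 2))
      - (alpha 0 - alpha 2) * evalAt (τ l) (xvar + bracket (alpha 1))
        * evalAt (τ (l + 1)) (xvar + bracket (alpha 0) + bracket (alpha 2))
      + (alpha 0 - alpha 1) * evalAt (τ l) (xvar + bracket (alpha 2))
        * evalAt (τ (l + 1)) (xvar + bracket (alpha 0) + bracket (alpha 1)) = 0

/-! All the substitutions above are legitimate, and all the sums are locally finite. -/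

theorem hasSubst_X {σ : Type*} (f : ℕ+ → σ) (hf : Function.Injective f) :
    HasSubst (fun n => (X (f n) : MvPowerSeries σ K)) where
  const_coeff n := by simp
  coeff_zero d := by
    classical
    apply Set.Subsingleton.finite
    intro m hm n hn
    simp only [Set.mem_ofPred_eq, coeff_X, ne_eq, ite_eq_right_iff, one_ne_zero, imp_false,
      not_not] at hm hn
    have h := hm.symm.trans hn
    exact hf (Finsupp.single_left_injective one_ne_zero h)

theorem hasSubst_bracket {σ : Type*} {α : MvPowerSeries σ K} (hα : constantCoeff α = 0) :
    HasSubst (bracket α) where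
  const_coeff n := by simp [bracket, hα]
  coeff_zero d := by
    refine Set.Finite.subset
      ((Set.finite_Iic (d.degree + 1)).preimage PNat.coe_injective.injOn) ?_
    intro (n : ℕ+) hn
    by_contra hlt
    apply hn
    have h1 : d.degree + 1 < (n : ℕ) := by simpa using hlt
    have : coeff d (α ^ (n : ℕ)) = 0 := by
      apply coeff_eq_zero_of_constantCoeff_nilpotent (m := 1)
      · simpa using hα
      · omega
    simp only [bracket, map_smul, this, smul_zero]

theorem hasSubst_neg_bracket {σ : Type*} {α : MvPowerSeries σ K} (hα : constantCoeff α = 0) :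
    HasSubst (-bracket α) where
  const_coeff n := by simpa using (hasSubst_bracket hα).const_coeff n
  coeff_zero d := by simpa using (hasSubst_bracket hα).coeff_zero d

theorem hasSubst_tvar'_sub : HasSubst (tvar' - bracket (lamInv : BilinearRing K)) := by
  rw [sub_eq_add_neg]
  exact (hasSubst_X _ (Sum.inl_injective.comp Sum.inr_injective)).add
    (hasSubst_neg_bracket (by simp [lamInv]))

theorem hasSubst_tvar_add : HasSubst (tvar + bracket (lamInv : BilinearRing K)) :=
  (hasSubst_X _ (Sum.inl_injective.comp Sum.inl_injective)).add
    (hasSubst_bracket (by simp [lamInv]))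

theorem hasSubst_xvar_add (i : Fin 3) :
    HasSubst (xvar + bracket (alpha i : ThreeTermRing K)) :=
  (hasSubst_X _ Sum.inl_injective).add (hasSubst_bracket (by simp [alpha]))

theorem hasSubst_xvar_add_add (i j : Fin 3) :
    HasSubst (xvar + bracket (alpha i : ThreeTermRing K) + bracket (alpha j)) :=
  (hasSubst_xvar_add i).add (hasSubst_bracket (by simp [alpha]))

theorem coeff_mul_lam_pow (f : BilinearRing K) (n : ℕ) (m : (ℕ+ ⊕ ℕ+) ⊕ Spectral →₀ ℕ)
    (h : coeff m (f * lam ^ n) ≠ 0) :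
    n ≤ m (Sum.inr Spectral.lam) ∧
      coeff (m - Finsupp.single (Sum.inr Spectral.lam) n) f ≠ 0 := by
  classical
  rw [lam, X_pow_eq, coeff_mul_monomial] at h
  split_ifs at h with hle
  · exact ⟨by simpa using hle (Sum.inr Spectral.lam), by simpa using h⟩
  · exact absurd rfl h

theorem xi_finite (a : ℕ+ → BilinearRing K) (m : (ℕ+ ⊕ ℕ+) ⊕ Spectral →₀ ℕ) :
    (Function.support fun n : ℕ+ => coeff m (a n * lam ^ (n : ℕ))).Finite := by
  refine Set.Finite.subset
    ((Set.finite_Iic (m (Sum.inr Spectral.lam))).preimage PNat.coe_injective.injOn) ?_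
  intro (n : ℕ+) hn
  exact (coeff_mul_lam_pow _ _ _ hn).1

theorem hasSubst_xi (a : ℕ+ → BilinearRing K) : PowerSeries.HasSubst (xi a) := by
  apply PowerSeries.HasSubst.of_constantCoeff_zero
  change (∑ᶠ n : ℕ+, coeff 0 (a n * lam ^ (n : ℕ))) = 0
  apply finsum_eq_zero_of_forall_eq_zero
  intro n
  by_contra h
  have := (coeff_mul_lam_pow _ _ _ h).1
  have := n.pos
  simp at *

/-- The weight of a monomial, where `tₙ` and `t'ₙ` have weight `n`. -/
def timeWeight : ((ℕ+ ⊕ ℕ+) ⊕ Spectral →₀ ℕ) →+ ℕ :=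
  Finsupp.weight (Sum.elim (Sum.elim (fun n : ℕ+ => (n : ℕ)) (fun n : ℕ+ => (n : ℕ))) (fun _ : Spectral => 0))

/-- The series in which the exponent of `λ` in each monomial is at most its weight. -/
def boundedLam (K : Type*) [Field K] : Subring (BilinearRing K) where
  carrier := {f | ∀ m, coeff m f ≠ 0 → m (Sum.inr Spectral.lam) ≤ timeWeight m}
  zero_mem' := fun m h => absurd (by simp) h
  one_mem' := by
    classical
    intro m h
    rw [coeff_one] at h
    have : m = 0 := by
      by_contra h0
      exact h (if_neg h0)
    simp [this]
  add_mem' := by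
    intro f g hf hg m h
    by_cases h1 : coeff m f = 0
    · exact hg m (by simpa [h1] using h)
    · exact hf m h1
  neg_mem' := by
    intro f hf m h
    exact hf m (by simpa using h)
  mul_mem' := by
    classical
    intro f g hf hg m h
    rw [coeff_mul] at h
    obtain ⟨⟨p, q⟩, hpq, hne⟩ := Finset.exists_ne_zero_of_sum_ne_zero h
    rw [Finset.HasAntidiagonal.mem_antidiagonal] at hpq
    subst hpq
    have h1 := hf p (left_ne_zero_of_mul hne)
    have h2 := hg q (right_ne_zero_of_mul hne)
    simpa using add_le_add h1 h2

theorem boundedLam_finsum {ι : Type*} (f : BilinearRing K) (c : (_ →₀ ℕ) → ι → K)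
    (g : ι → BilinearRing K) (hg : ∀ i, g i ∈ boundedLam K)
    (hf : ∀ m, coeff m f = ∑ᶠ i, c m i * coeff m (g i)) : f ∈ boundedLam K := by
  intro m h
  rw [hf] at h
  obtain ⟨i, hi⟩ : ∃ i, c m i * coeff m (g i) ≠ 0 := by
    by_contra! h0
    exact h (finsum_eq_zero_of_forall_eq_zero h0)
  exact hg i m (right_ne_zero_of_mul hi)

theorem X_mem_boundedLam (v : (ℕ+ ⊕ ℕ+) ⊕ Spectral) (hv : v ≠ Sum.inr Spectral.lam) :
    (X v : BilinearRing K) ∈ boundedLam K := by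
  classical
  intro m h
  rw [coeff_X] at h
  have : m = Finsupp.single v 1 := by
    by_contra h0
    exact h (if_neg h0)
  simp [this, hv]

theorem smul_mem_boundedLam (c : K) (f : BilinearRing K) (hf : f ∈ boundedLam K) :
    c • f ∈ boundedLam K := by
  intro m h
  rw [coeff_smul] at h
  exact hf m (right_ne_zero_of_mul h)

theorem evalAt_mem_boundedLam (τ : TimeSeries K) (a : ℕ+ → BilinearRing K) (ha : HasSubst a)
    (h : ∀ n, a n ∈ boundedLam K) : evalAt τ a ∈ boundedLam K :=
  boundedLam_finsum _ (fun _ d => coeff d τ) (fun d => d.prod fun s e => a s ^ e)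
    (fun _ => Subring.prod_mem _ fun n _ => Subring.pow_mem _ (h n) _)
    (fun m => by simpa using coeff_subst ha τ m)

theorem bracket_mem_boundedLam (n : ℕ+) : bracket (lamInv : BilinearRing K) n ∈ boundedLam K :=
  smul_mem_boundedLam _ _ (Subring.pow_mem _ (X_mem_boundedLam _ (by simp)) _)

theorem X_mul_lam_mem_boundedLam (v : ℕ+ ⊕ ℕ+) (n : ℕ) (hv : Sum.elim (↑) (↑) v = n) :
    (X (Sum.inl v) : BilinearRing K) * lam ^ n ∈ boundedLam K := by
  classical
  intro m h
  obtain ⟨h1, h2⟩ := coeff_mul_lam_pow _ _ _ h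
  rw [coeff_X] at h2
  have h3 : m - Finsupp.single (Sum.inr Spectral.lam) n = Finsupp.single (Sum.inl v) 1 := by
    by_contra h0
    exact h2 (if_neg h0)
  have h4 : m = Finsupp.single (Sum.inl v) 1 + Finsupp.single (Sum.inr Spectral.lam) n := by
    rw [← h3, tsub_add_cancel_of_le]
    simpa using h1
  rw [h4]
  simp [timeWeight, Finsupp.weight_single, hv]

theorem formalExp_mem_boundedLam :
    formalExp (xi (tvar' - tvar : ℕ+ → BilinearRing K)) ∈ boundedLam K := by
  have hxi : xi (tvar' - tvar : ℕ+ → BilinearRing K) ∈ boundedLam K := by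
    refine boundedLam_finsum _ (fun _ _ => 1)
      (fun n : ℕ+ => (tvar' - tvar : ℕ+ → BilinearRing K) n * lam ^ (n : ℕ)) ?_
      (fun m => by simp only [one_mul]; rfl)
    intro n
    rw [Pi.sub_apply, sub_mul]
    exact Subring.sub_mem _ (X_mul_lam_mem_boundedLam _ _ rfl) (X_mul_lam_mem_boundedLam _ _ rfl)
  exact boundedLam_finsum _ (fun _ d => PowerSeries.coeff d (PowerSeries.exp K))
    (fun d => xi (tvar' - tvar) ^ d) (fun _ => Subring.pow_mem _ hxi _)
    (fun m => PowerSeries.coeff_subst (hasSubst_xi _) _ m)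

/-- The sum that defines the residue of the integrand is finite. -/
theorem residue_integrand_finite (k : ℕ) (τ ρ : TimeSeries K) (s : ℕ+ ⊕ ℕ+ →₀ ℕ) :
    (Function.support fun a : ℕ =>
      coeff (spectralMonomial s a (a + 1)) (integrand k τ ρ)).Finite := by
  have hmem : formalExp (xi (tvar' - tvar)) * evalAt τ (tvar' - bracket lamInv)
      * evalAt ρ (tvar + bracket lamInv) ∈ boundedLam K := by
    refine Subring.mul_mem _ (Subring.mul_mem _ formalExp_mem_boundedLam
      (evalAt_mem_boundedLam _ _ hasSubst_tvar'_sub fun n => ?_))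
      (evalAt_mem_boundedLam _ _ hasSubst_tvar_add fun n => ?_)
    · exact Subring.sub_mem _ (X_mem_boundedLam _ (by simp)) (bracket_mem_boundedLam n)
    · exact Subring.add_mem _ (X_mem_boundedLam _ (by simp)) (bracket_mem_boundedLam n)
  have heq : integrand k τ ρ = formalExp (xi (tvar' - tvar)) * evalAt τ (tvar' - bracket lamInv)
      * evalAt ρ (tvar + bracket lamInv) * lam ^ k := by
    simp only [integrand]
    ring
  have hlam : ∀ a, spectralMonomial s a (a + 1) (Sum.inr Spectral.lam) = a := by
    intro a
    rw [spectralMonomial, Finsupp.add_apply, Finsupp.add_apply, Finsupp.embDomain_of_notMem_range]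
    · simp
    · simp
  have hw : ∀ a, timeWeight (spectralMonomial s a (a + 1))
      = timeWeight (s.embDomain Function.Embedding.inl) := by
    intro a
    simp [spectralMonomial, timeWeight, Finsupp.weight_single]
  refine Set.Finite.subset
    (Set.finite_Iic (timeWeight (s.embDomain Function.Embedding.inl) + k)) ?_
  intro a ha
  rw [Function.mem_support, heq] at ha
  obtain ⟨h1, h2⟩ := coeff_mul_lam_pow _ _ _ ha
  have h3 := hmem _ h2
  have h5 : timeWeight (spectralMonomial s a (a + 1) - Finsupp.single (Sum.inr Spectral.lam) k)
      = timeWeight (spectralMonomial s a (a + 1)) := by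
    conv_rhs => rw [← tsub_add_cancel_of_le (show Finsupp.single (Sum.inr Spectral.lam) k
      ≤ spectralMonomial s a (a + 1) by simpa using h1)]
    simp [timeWeight, Finsupp.weight_single]
  rw [h5, hw, Finsupp.tsub_apply, hlam, Finsupp.single_eq_same] at h3
  rw [Set.mem_Iic]
  omega

end MKP

end

/-! Both systems are compared at the Miwa points `t = x`, `t' = x + [α_1] + ⋯ + [α_N]`. There
`e^{ξ(t'-t,λ)}` becomes `∏ (1 - α_i λ)⁻¹`. With `k = l - l'` and `N = k + 2 + q`, partial fractions
turn the residue into `∑_i α_i^q / ∏_{j ≠ i} (α_i - α_j) · τ_l(x + ∑_{j ≠ i} [α_j]) · τ_{l'}(x +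
[α_i])`; `diffProd_mul_subst_residue` is this formula with denominators cleared. For `k = 1`, `q =
0`, `N = 3` it is the three term equation up to a Vandermonde factor, so the hierarchy implies the
three term equations.

For the converse, fix `c` and put `g(S) = τ_{c+|S|}(x + ∑_{i ∈ S} [α_i])`. The three term equations
say that `g` satisfies the shortest incidence relations of a flag. No `g(S)` vanishes because no
`τ_l` does, so one may cancel in the field of fractions, and an induction gives all incidence
relations between sets `S` and `B` with `|S| ≥ |B| + 2` (`ThreeTermRelation.exchangeSum_eq_zero`).
Taking `|S| = N`, `|B| = q` and setting the variables of `B` to zero produces the factors `α_i^q`,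
so the residue vanishes at Miwa points. Power sums in arbitrarily many variables satisfy no common
relation, so a series vanishing at all Miwa points is zero (`eq_zero_of_subst_miwaArg`). -/

noncomputable section

namespace MKP

open MvPowerSeries Finset
open scoped MvPowerSeries.WithPiTopology

set_option linter.unusedSectionVars false

variable {K : Type*} [Field K] [CharZero K]

/-! ### Coefficients with respect to a subset of the variables, and termwise substitution. -/

section Slices

variable {σ τ υ : Type*}

theorem hasSubst_sumElim {a : σ → MvPowerSeries υ K} {c : τ → MvPowerSeries υ K}
    (ha : HasSubst a) (hc : HasSubst c) : HasSubst (Sum.elim a c) where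
  const_coeff := by
    rintro (s | t)
    · exact ha.const_coeff s
    · exact hc.const_coeff t
  coeff_zero d := by
    refine (((ha.coeff_zero d).image Sum.inl).union ((hc.coeff_zero d).image Sum.inr)).subset ?_
    rintro (s | t) h
    · exact Or.inl ⟨s, h, rfl⟩
    · exact Or.inr ⟨t, h, rfl⟩

theorem hasSubst_X_inl : HasSubst (fun s : σ => (X (Sum.inl s) : MvPowerSeries (σ ⊕ τ) K)) :=
  have : Filter.TendstoCofinite (Sum.inl : σ → σ ⊕ τ) :=
    inferInstanceAs (Filter.TendstoCofinite (Function.Embedding.inl : σ ↪ σ ⊕ τ))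
  HasSubst.X_comp (f := Sum.inl)

theorem hasSubst_X_inr : HasSubst (fun s : τ => (X (Sum.inr s) : MvPowerSeries (σ ⊕ τ) K)) :=
  have : Filter.TendstoCofinite (Sum.inr : τ → σ ⊕ τ) :=
    inferInstanceAs (Filter.TendstoCofinite (Function.Embedding.inr : τ ↪ σ ⊕ τ))
  HasSubst.X_comp (f := Sum.inr)

/-- The inclusion of the series in the variables `σ` into the series in the variables `σ ⊕ τ`. -/
def inlSeries (h : MvPowerSeries σ K) : MvPowerSeries (σ ⊕ τ) K :=
  subst (fun s => (X (Sum.inl s) : MvPowerSeries (σ ⊕ τ) K)) h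

theorem hasSubst_inlSeries {a : υ → MvPowerSeries σ K} (ha : HasSubst a) :
    HasSubst (fun s => (inlSeries (a s) : MvPowerSeries (σ ⊕ τ) K)) := by
  simpa using! ha.comp (hasSubst_X_inl (σ := σ) (τ := τ) (K := K))

theorem inlSeries_eq_rename (h : MvPowerSeries σ K) :
    (inlSeries h : MvPowerSeries (σ ⊕ τ) K) = rename (Function.Embedding.inl : σ ↪ σ ⊕ τ) h :=
  (rename_eq_subst (Function.Embedding.inl : σ ↪ σ ⊕ τ) h).symm

theorem coeff_inlSeries (h : MvPowerSeries σ K) (s : σ →₀ ℕ) (e : τ →₀ ℕ) [Decidable (e = 0)] :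
    coeff (s.sumElim e) (inlSeries h : MvPowerSeries (σ ⊕ τ) K)
      = if e = 0 then coeff s h else 0 := by
  rw [inlSeries_eq_rename]
  split_ifs with he
  · subst he
    rw [← coeff_embDomain_rename (Function.Embedding.inl : σ ↪ σ ⊕ τ) h s]
    congr 2
    ext (i | i)
    · rw [Finsupp.sumElim_inl]
      exact (Finsupp.embDomain_apply_self Function.Embedding.inl _ _).symm
    · rw [Finsupp.sumElim_inr, Finsupp.embDomain_of_notMem_range]
      · simp
      · simp
  · apply coeff_rename_eq_zero
    rintro ⟨y, hy⟩
    apply he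
    ext t
    have := DFunLike.congr_fun hy (Sum.inr t)
    rw [Finsupp.mapDomain_of_notMem_range _ _ (by simp)] at this
    simpa using this.symm

theorem sumElim_comap (m : σ ⊕ τ →₀ ℕ) :
    ∃ (s : σ →₀ ℕ) (e : τ →₀ ℕ), m = s.sumElim e := by
  obtain ⟨p, hp⟩ := (Finsupp.sumFinsuppEquivProdFinsupp (α := σ) (β := τ) (γ := ℕ)).symm.surjective m
  exact ⟨p.1, p.2, by rw [← hp]; rfl⟩

/-- The coefficient of the `τ`-monomial `e`, as a series in the variables `σ`. -/
def slice (e : τ →₀ ℕ) (F : MvPowerSeries (σ ⊕ τ) K) : MvPowerSeries σ K :=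
  fun s => coeff (s.sumElim e) F

@[simp]
theorem coeff_slice (e : τ →₀ ℕ) (F : MvPowerSeries (σ ⊕ τ) K) (s : σ →₀ ℕ) :
    coeff s (slice e F) = coeff (s.sumElim e) F := rfl

theorem ext_slice {F G : MvPowerSeries (σ ⊕ τ) K} (h : ∀ e, slice e F = slice e G) : F = G := by
  ext m
  obtain ⟨s, e, rfl⟩ := sumElim_comap m
  rw [← coeff_slice, h, coeff_slice]

@[simp]
theorem slice_zero (e : τ →₀ ℕ) : slice e (0 : MvPowerSeries (σ ⊕ τ) K) = 0 := by
  ext s; simp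

theorem slice_mul [DecidableEq τ] (e : τ →₀ ℕ) (F G : MvPowerSeries (σ ⊕ τ) K) :
    slice e (F * G) = ∑ p ∈ antidiagonal e, slice p.1 F * slice p.2 G := by
  classical
  ext s
  simp only [coeff_slice, coeff_mul, map_sum]
  rw [← Finsupp.image_sumElim_product_antidiagonal, Finset.sum_image, Finset.sum_product,
    Finset.sum_comm]
  rintro ⟨⟨a, b⟩, c, d⟩ _ ⟨⟨a', b'⟩, c', d'⟩ _ h
  simp only [Prod.mk.injEq, Finsupp.ext_iff, Sum.forall, Finsupp.sumElim_inl,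
    Finsupp.sumElim_inr] at h ⊢
  tauto

theorem slice_inlSeries_mul_monomial (h : MvPowerSeries σ K) (e e' : τ →₀ ℕ) [Decidable (e = e')] :
    slice e (inlSeries h * monomial (Finsupp.sumElim 0 e') 1) = if e = e' then h else 0 := by
  classical
  ext s
  rw [coeff_slice, coeff_mul_monomial, mul_one]
  by_cases hle : e' ≤ e
  · obtain ⟨d, rfl⟩ := exists_add_of_le hle
    have h1 : s.sumElim (e' + d) = s.sumElim d + Finsupp.sumElim 0 e' := by
      rw [← Finsupp.sumElim_add, add_zero, add_comm]
    rw [h1, if_pos le_add_self, add_tsub_cancel_right, coeff_inlSeries]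
    simp only [add_eq_left]
    split_ifs <;> simp
  · rw [if_neg, if_neg]
    · simp
    · rintro rfl; exact hle le_rfl
    · intro h2
      exact hle fun t => by simpa using h2 (Sum.inr t)

theorem subst_inlSeries {a : σ → MvPowerSeries υ K} {c : τ → MvPowerSeries υ K}
    (ha : HasSubst a) (hc : HasSubst c) (h : MvPowerSeries σ K) :
    subst (Sum.elim a c) (inlSeries h) = subst a h := by
  have hac := hasSubst_sumElim ha hc
  rw [inlSeries, subst_comp_subst_apply hasSubst_X_inl hac]
  congr 1
  funext s
  rw [subst_X hac]; rfl

section HasSum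

variable [UniformSpace K] [DiscreteUniformity K]

theorem hasSum_coeff_ite {ι : Type*} [DecidableEq ι] (f : ι → MvPowerSeries σ K) (i : ι)
    (s : σ →₀ ℕ) : HasSum (fun j => coeff s (if i = j then f j else 0)) (coeff s (f i)) := by
  have := hasSum_single (f := fun j => coeff s (if i = j then f j else 0)) i
    (fun j hj => by simp [hj.symm])
  simpa using this

theorem hasSum_slice_self (F : MvPowerSeries (σ ⊕ τ) K) :
    HasSum (fun e => inlSeries (slice e F) * monomial (Finsupp.sumElim 0 e) 1) F := by
  classical
  rw [WithPiTopology.hasSum_iff_hasSum_coeff]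
  intro m
  obtain ⟨s, e, rfl⟩ := sumElim_comap m
  simp only [← coeff_slice, slice_inlSeries_mul_monomial]
  exact hasSum_coeff_ite (fun e => slice e F) e s

theorem hasSum_map_subst {ι : Type*} {a : σ → MvPowerSeries υ K} (ha : HasSubst a)
    {f : ι → MvPowerSeries σ K} {F : MvPowerSeries σ K} (h : HasSum f F) :
    HasSum (fun i => subst a (f i)) (subst a F) := by
  have := h.map (substAlgHom (R := K) ha).toAddMonoidHom
    (by simpa using! continuous_subst (R := K) ha)
  simpa using! this

theorem hasSum_slice {a : σ → MvPowerSeries υ K} {c : τ → MvPowerSeries υ K}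
    (ha : HasSubst a) (hc : HasSubst c) (F : MvPowerSeries (σ ⊕ τ) K) :
    HasSum (fun e => subst a (slice e F) * e.prod fun s k => c s ^ k) (subst (Sum.elim a c) F) := by
  have hac := hasSubst_sumElim ha hc
  convert! hasSum_map_subst hac (hasSum_slice_self F) using 2 with e
  rw [subst_mul hac, subst_inlSeries ha hc, subst_monomial hac, map_one, one_mul,
    Finsupp.prod_sumElim]
  simp [Function.comp_def]

end HasSum

theorem slice_subst {a : σ → MvPowerSeries υ K} (ha : HasSubst a) (e : τ →₀ ℕ)
    (F : MvPowerSeries (σ ⊕ τ) K) :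
    slice e (subst (Sum.elim (fun s => (inlSeries (a s) : MvPowerSeries (υ ⊕ τ) K))
      (fun t => X (Sum.inr t))) F) = subst a (slice e F) := by
  classical
  -- The discrete uniformity on `K` serves only to make substitution continuous, so that it can be
  -- applied to infinite sums term by term.
  let _ : UniformSpace K := ⊥
  have := hasSum_slice (hasSubst_inlSeries ha) hasSubst_X_inr F
  rw [WithPiTopology.hasSum_iff_hasSum_coeff] at this
  ext s
  have h1 := this (s.sumElim e)
  have h2 : ∀ e' : τ →₀ ℕ, (subst (fun s => (inlSeries (a s) : MvPowerSeries (υ ⊕ τ) K)) (slice e' F)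
      * e'.prod fun t k => (X (Sum.inr t) : MvPowerSeries (υ ⊕ τ) K) ^ k)
      = inlSeries (subst a (slice e' F)) * monomial (Finsupp.sumElim 0 e') 1 := by
    intro e'
    congr 1
    · rw [inlSeries, subst_comp_subst_apply ha hasSubst_X_inl]
      rfl
    · rw [monomial_one_eq, Finsupp.prod_sumElim]
      simp [Function.comp_def]
  simp only [h2, ← coeff_slice, slice_inlSeries_mul_monomial] at h1
  refine h1.unique ?_
  exact hasSum_coeff_ite (fun e => subst a (slice e F)) e s

end Slices

end MKP

end

noncomputable section

namespace MKP

open MvPowerSeries Finset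

/-! ### Incidence relations of flags from the three term relation. -/

section Exchange

variable {ι L : Type*} [DecidableEq ι] [Field L]

/-- The sum `∑_{i ∈ S} ∏_{b ∈ B} (α_i - α_b) / ∏_{j ∈ S, j ≠ i} (α_i - α_j) g(S \ i) g(B ∪ i)` of the
incidence relations of flags. -/
def exchangeSum (α : ι → L) (g : Finset ι → L) (S B : Finset ι) : L :=
  ∑ i ∈ S, (∏ b ∈ B, (α i - α b)) / (∏ j ∈ S.erase i, (α i - α j)) * g (S.erase i) * g (insert i B)

variable {α : ι → L} {g : Finset ι → L}

/-- The three term incidence relation. -/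
def ThreeTermRelation (α : ι → L) (g : Finset ι → L) : Prop :=
  ∀ (A : Finset ι) (i a b : ι), i ∉ A → a ∉ A → b ∉ A → i ≠ a → i ≠ b → a ≠ b →
    (α a - α b) * g (insert i A) * g (insert a (insert b A))
      - (α i - α b) * g (insert a A) * g (insert i (insert b A))
      + (α i - α a) * g (insert b A) * g (insert i (insert a A)) = 0

/-- Every index in `C` is killed by the numerator, and for the remaining index `s` numerator and
denominator agree. -/
theorem exchangeSum_of_insert_subset {C : Finset ι} {s : ι} (hα : Function.Injective α) (hs : s ∉ C) :
    exchangeSum α g (insert s C) C = g C * g (insert s C) := by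
  rw [exchangeSum, Finset.sum_eq_single s]
  · rw [erase_insert hs, div_self, one_mul]
    exact prod_ne_zero_iff.2 fun j hj => sub_ne_zero.2 (hα.ne (by rintro rfl; exact hs hj))
  · intro i hi his
    have : i ∈ C := (mem_insert.1 hi).resolve_left his
    rw [prod_eq_zero this (sub_self _)]
    simp
  · simp

/-- The recursion behind both inductions: the three term relation for `i, a, b` over `B` is applied
to each summand. Its degenerate cases `i = a` and `i = b` hold trivially, and for `i ∈ B` all terms
vanish. -/
theorem ThreeTermRelation.exchangeSum_mul (h : ThreeTermRelation α g) (S : Finset ι) {B : Finset ι} {a b : ι}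
    (ha : a ∉ B) (hb : b ∉ B) (hab : a ≠ b) :
    exchangeSum α g S B * ((α a - α b) * g (insert a (insert b B)))
      = g (insert a B) * exchangeSum α g S (insert b B)
        - g (insert b B) * exchangeSum α g S (insert a B) := by
  simp only [exchangeSum, sum_mul, mul_sum, ← sum_sub_distrib]
  refine sum_congr rfl fun i _ => ?_
  rw [prod_insert ha, prod_insert hb]
  by_cases hi : i ∈ B
  · rw [prod_eq_zero hi (sub_self _)]; simp
  · have key : (α a - α b) * g (insert i B) * g (insert a (insert b B))
      - (α i - α b) * g (insert a B) * g (insert i (insert b B))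
      + (α i - α a) * g (insert b B) * g (insert i (insert a B)) = 0 := by
      by_cases hia : i = a
      · subst hia; rw [insert_idem]; ring
      by_cases hib : i = b
      · subst hib
        rw [insert_idem, insert_comm a]
        ring
      exact h B i a b hi ha hb hia hib hab
    linear_combination (∏ b ∈ B, (α i - α b)) / (∏ j ∈ S.erase i, (α i - α j)) * g (S.erase i) * key

theorem exchangeSum_of_subset {S B : Finset ι} (hα : Function.Injective α) (hBS : B ⊆ S)
    (hc : #S = #B + 1) : exchangeSum α g S B = g B * g S := by
  obtain ⟨s, hs⟩ := card_eq_one.1 (show #(S \ B) = 1 by rw [card_sdiff_of_subset hBS]; omega)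
  have hsB : s ∉ B := (mem_sdiff.1 (hs ▸ mem_singleton_self s)).2
  have : S = insert s B := by
    rw [← sdiff_union_of_subset hBS, hs]; rfl
  rw [this, exchangeSum_of_insert_subset hα hsB]

theorem exists_pair_sdiff {S B : Finset ι} (h : #B + 2 ≤ #S) :
    ∃ a b, a ∈ S ∧ b ∈ S ∧ a ∉ B ∧ b ∉ B ∧ a ≠ b := by
  have h1 : 1 < #(S \ B) := by
    have := le_card_sdiff B S
    omega
  obtain ⟨a, ha, b, hb, hab⟩ := one_lt_card.1 h1
  rw [mem_sdiff] at ha hb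
  exact ⟨a, b, ha.1, hb.1, ha.2, hb.2, hab⟩

theorem ThreeTermRelation.exchangeSum_eq_zero_of_pair (h : ThreeTermRelation α g)
    (hα : Function.Injective α) (hg : ∀ A, g A ≠ 0) {S B : Finset ι} {a b : ι}
    (ha : a ∉ B) (hb : b ∉ B) (hab : a ≠ b)
    (h1 : g (insert a B) * exchangeSum α g S (insert b B)
      = g (insert b B) * exchangeSum α g S (insert a B)) :
    exchangeSum α g S B = 0 := by
  have := h.exchangeSum_mul S ha hb hab
  rw [h1, sub_self] at this
  exact (mul_eq_zero.1 this).resolve_right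
    (mul_ne_zero (sub_ne_zero.2 (hα.ne hab)) (hg _))

/-- The boundary case `|S| = |B| + 1`, where the sum is not zero but a product symmetric enough to
cancel in the recursion. The induction on `|B \ S|` exchanges some `b ∈ B \ S` for some `s ∈ S \ B`.
-/
theorem ThreeTermRelation.exchangeSum_eq_mul (h : ThreeTermRelation α g)
    (hα : Function.Injective α) (hg : ∀ A, g A ≠ 0) (n : ℕ) :
    ∀ S B : Finset ι, #(B \ S) ≤ n → #S = #B + 1 → exchangeSum α g S B = g B * g S := by
  induction n with
  | zero =>
    intro S B hn
    exact exchangeSum_of_subset hα (sdiff_eq_empty_iff_subset.1 (card_eq_zero.1 (by omega)))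
  | succ n ih =>
    intro S B hn hc
    by_cases hBS : B ⊆ S
    · exact exchangeSum_of_subset hα hBS hc
    obtain ⟨b, hb, hbS⟩ := not_subset.1 hBS
    obtain ⟨s, hs, hsB⟩ := exists_mem_notMem_of_card_lt_card (show #B < #S by omega)
    have hC : #(B.erase b) + 1 = #B := card_erase_add_one hb
    have hCS : #(B.erase b \ S) ≤ n := by
      rw [erase_sdiff_comm, card_erase_of_mem (mem_sdiff.2 ⟨hb, hbS⟩)]
      omega
    have hins : ∀ a ∈ S, insert a (B.erase b) \ S = B.erase b \ S := fun a ha =>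
      insert_sdiff_of_mem _ ha
    -- Adding to `B.erase b` an element of `S` does not enlarge the difference with `S`, so the
    -- induction hypothesis evaluates both sums on the right of the recursion, and they cancel.
    have hzero : exchangeSum α g S (B.erase b) = 0 := by
      obtain ⟨p, q, hpS, hqS, hp, hq, hpq⟩ :=
        exists_pair_sdiff (show #(B.erase b) + 2 ≤ #S by omega)
      refine h.exchangeSum_eq_zero_of_pair hα hg hp hq hpq ?_
      rw [ih _ (insert q _) (by rwa [hins _ hqS]) (by rw [card_insert_of_notMem hq]; omega),
        ih _ (insert p _) (by rwa [hins _ hpS]) (by rw [card_insert_of_notMem hp]; omega)]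
      ring
    have hsC : s ∉ B.erase b := fun hm => hsB (mem_of_mem_erase hm)
    have hsb : s ≠ b := by rintro rfl; exact hsB hb
    -- In the recursion for the pair `s, b` the left side is now zero, which determines the sum for
    -- `B` from the known one for `B` with `b` replaced by `s`.
    have key := h.exchangeSum_mul S hsC (notMem_erase b B) hsb
    rw [hzero, zero_mul, ih _ (insert s _) (by rwa [hins _ hs]) (by rw [card_insert_of_notMem hsC]; omega),
      insert_erase hb] at key
    refine mul_left_cancel₀ (hg (insert s (B.erase b))) ?_
    linear_combination -key

/-- The three term relations imply all the incidence relations. -/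
theorem ThreeTermRelation.exchangeSum_eq_zero (h : ThreeTermRelation α g)
    (hα : Function.Injective α) (hg : ∀ A, g A ≠ 0) (S B : Finset ι) (hc : #B + 2 ≤ #S) :
    exchangeSum α g S B = 0 := by
  obtain ⟨k, hk⟩ := Nat.exists_eq_add_of_le hc
  induction k generalizing B with
  | zero =>
    obtain ⟨a, b, -, -, ha, hb, hab⟩ := exists_pair_sdiff hc
    refine h.exchangeSum_eq_zero_of_pair hα hg ha hb hab ?_
    rw [h.exchangeSum_eq_mul hα hg _ _ (insert b B) le_rfl (by rw [card_insert_of_notMem hb]; omega),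
      h.exchangeSum_eq_mul hα hg _ _ (insert a B) le_rfl (by rw [card_insert_of_notMem ha]; omega)]
    ring
  | succ k ih =>
    obtain ⟨a, b, -, -, ha, hb, hab⟩ := exists_pair_sdiff hc
    refine h.exchangeSum_eq_zero_of_pair hα hg ha hb hab ?_
    rw [ih _ (by rw [card_insert_of_notMem hb]; omega) (by rw [card_insert_of_notMem hb]; omega),
      ih _ (by rw [card_insert_of_notMem ha]; omega) (by rw [card_insert_of_notMem ha]; omega)]
    simp

end Exchange

end MKP

end

noncomputable section

namespace MKP

open Finset

set_option linter.unusedSectionVars false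

variable {K : Type*} [Field K] [CharZero K]

/-! ### The formal exponential and `exp(-log(1 - y)) = 1/(1 - y)`. -/

section Exponential

open MvPowerSeries

variable {σ υ : Type*}

theorem subst_powerSeriesSubst {a : σ → MvPowerSeries υ K} (ha : HasSubst a)
    {f : MvPowerSeries σ K} (hf : PowerSeries.HasSubst f) (p : PowerSeries K) :
    subst a (PowerSeries.subst f p) = PowerSeries.subst (subst a f) p :=
  subst_comp_subst_apply hf.const ha p

theorem formalExp_X_add_X :
    formalExp (X 0 + X 1 : MvPowerSeries (Fin 2) K) = formalExp (X 0) * formalExp (X 1) := by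
  ext e
  rw [formalExp, formalExp, formalExp, PowerSeries.coeff_subst_X_zero_add_X_one,
    PowerSeries.coeff_subst_X_zero_subst_mul_X_one]
  simp only [PowerSeries.coeff_exp, one_div, map_inv₀, map_natCast]
  have h := Nat.add_choose_mul_factorial_mul_factorial (e 0) (e 1)
  have h' : (((e 0 + e 1).choose (e 0) : ℕ) : K) * ((e 0).factorial : K) * ((e 1).factorial : K)
      = ((e 0 + e 1).factorial : K) := by
    rw [Nat.choose_symm_add]; exact_mod_cast h
  have h0 : ((e 0).factorial : K) ≠ 0 := by exact_mod_cast (e 0).factorial_ne_zero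
  have h1 : ((e 1).factorial : K) ≠ 0 := by exact_mod_cast (e 1).factorial_ne_zero
  have h2 : ((e 0 + e 1).factorial : K) ≠ 0 := by exact_mod_cast (e 0 + e 1).factorial_ne_zero
  field_simp
  linear_combination h'

theorem formalExp_add {f g : MvPowerSeries σ K} (hf : PowerSeries.HasSubst f)
    (hg : PowerSeries.HasSubst g) : formalExp (f + g) = formalExp f * formalExp g := by
  have ha : HasSubst ![f, g] := hasSubst_of_constantCoeff_nilpotent (by
    intro i
    fin_cases i
    · exact hf
    · exact hg)
  have hX : ∀ i : Fin 2, PowerSeries.HasSubst (X i : MvPowerSeries (Fin 2) K) :=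
    fun i => PowerSeries.HasSubst.X i
  have := congrArg (subst ![f, g]) (formalExp_X_add_X (K := K))
  simp only [formalExp] at this ⊢
  rw [subst_mul ha, subst_powerSeriesSubst ha (hX 0), subst_powerSeriesSubst ha (hX 1),
    subst_powerSeriesSubst ha ((hX 0).add (hX 1)), subst_add ha, subst_X ha, subst_X ha] at this
  exact this

theorem formalExp_zero : formalExp (0 : MvPowerSeries σ K) = 1 := by
  rw [formalExp, PowerSeries.subst_zero_eq_C_constantCoeff]
  simp

theorem formalExp_sum {ι : Type*} (s : Finset ι) (f : ι → MvPowerSeries σ K)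
    (hf : ∀ i, PowerSeries.HasSubst (f i)) :
    formalExp (∑ i ∈ s, f i) = ∏ i ∈ s, formalExp (f i) := by
  classical
  have h : ∀ s : Finset ι, PowerSeries.HasSubst (∑ i ∈ s, f i) := fun s =>
    sum_mem (S := PowerSeries.HasSubst.ideal) fun i _ => hf i
  induction s using Finset.induction_on with
  | empty => simp [formalExp_zero]
  | insert i s hi ih => rw [sum_insert hi, prod_insert hi, formalExp_add (hf i) (h s), ih]

/-- The series `∑_{n ≥ 1} yⁿ / n = - log (1 - y)`. -/
def negLog (K : Type*) [Field K] : PowerSeries K := PowerSeries.mk fun n => (n : K)⁻¹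

theorem hasSubst_negLog : PowerSeries.HasSubst (negLog K) := by
  apply PowerSeries.HasSubst.of_constantCoeff_zero'
  simp [negLog]

/-- The left side has derivative zero and constant coefficient one. -/
theorem exp_subst_negLog :
    (PowerSeries.exp K).subst (negLog K) * (1 - PowerSeries.X) = 1 := by
  have hd : PowerSeries.derivative K (negLog K) = PowerSeries.mk 1 := by
    ext n
    rw [PowerSeries.coeff_derivative]
    simp only [negLog, PowerSeries.coeff_mk, Pi.one_apply]
    have : ((n : K) + 1) ≠ 0 := by exact_mod_cast n.succ_ne_zero
    push_cast
    field_simp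
  apply PowerSeries.derivative.ext
  · rw [Derivation.leibniz, PowerSeries.derivative_subst hasSubst_negLog,
      PowerSeries.derivative_exp, hd, map_sub, PowerSeries.derivative_one, PowerSeries.derivative_X,
      smul_eq_mul, smul_eq_mul]
    linear_combination (PowerSeries.exp K).subst (negLog K)
      * PowerSeries.mk_one_mul_one_sub_eq_one K
  · have h0 : PowerSeries.constantCoeff ((PowerSeries.exp K - 1).subst (negLog K)) = 0 := by
      apply PowerSeries.constantCoeff_subst_eq_zero
      · change PowerSeries.constantCoeff (negLog K) = 0
        simp [negLog]
      · simp
    rw [PowerSeries.subst_sub hasSubst_negLog, map_sub, sub_eq_zero] at h0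
    rw [map_mul, h0]
    have : PowerSeries.subst (negLog K) (1 : PowerSeries K) = 1 := by
      rw [← PowerSeries.coe_substAlgHom hasSubst_negLog, map_one]
    simp [this]

theorem formalExp_negLog_mul {y : MvPowerSeries σ K} (hy : PowerSeries.HasSubst y) :
    formalExp ((negLog K).subst y) * (1 - y) = 1 := by
  have := congrArg (PowerSeries.subst y) (exp_subst_negLog (K := K))
  rw [← PowerSeries.coe_substAlgHom hy, map_mul, map_sub, map_one,
    PowerSeries.substAlgHom_X, PowerSeries.coe_substAlgHom hy,
    PowerSeries.subst_comp_subst_apply hasSubst_negLog hy] at this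
  exact this

end Exponential

/-! ### Partial fractions with denominators cleared. -/

section Lagrange

variable {ι : Type*} [Fintype ι] [DecidableEq ι]

/-- The product of all differences `α_i - α_j` with `i ≠ j`. -/
def diffProd {R : Type*} [CommRing R] (α : ι → R) : R := ∏ i, ∏ j ∈ univ.erase i, (α i - α j)

/-- The cofactor of `∏_{j ≠ i} (α_i - α_j)` in the product of all differences. -/
def diffCofactor {R : Type*} [CommRing R] (α : ι → R) (i : ι) : R :=
  ∏ i' ∈ univ.erase i, ∏ j ∈ univ.erase i', (α i' - α j)

theorem diffCofactor_mul {R : Type*} [CommRing R] (α : ι → R) (i : ι) :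
    diffCofactor α i * ∏ j ∈ univ.erase i, (α i - α j) = diffProd α :=
  prod_erase_mul univ (fun i => ∏ j ∈ univ.erase i, (α i - α j)) (mem_univ i)

theorem diffProd_ne_zero {R : Type*} [CommRing R] [IsDomain R] {α : ι → R}
    (hα : Function.Injective α) : diffProd α ≠ 0 :=
  prod_ne_zero_iff.2 fun _ _ => prod_ne_zero_iff.2 fun _ hj =>
    sub_ne_zero.2 (hα.ne (ne_of_mem_erase hj).symm)

theorem map_diffProd {R S : Type*} [CommRing R] [CommRing S] (f : R →+* S) (α : ι → R) :
    f (diffProd α) = diffProd fun i => f (α i) := by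
  simp [diffProd]

theorem map_diffCofactor {R S : Type*} [CommRing R] [CommRing S] (f : R →+* S) (α : ι → R) (i : ι) :
    f (diffCofactor α i) = diffCofactor (fun i => f (α i)) i := by
  simp [diffCofactor]

-- This is Lagrange interpolation of `X ^ (N - 1)` at the `N` nodes `α_i⁻¹`; the powers of `α_i⁻¹`
-- are absorbed by the basis polynomials.
open Polynomial in
theorem sum_diffCofactor_mul_prod_of_field [Nonempty ι] {F : Type*} [Field F] {α : ι → F}
    (hα : Function.Injective α) (h0 : ∀ i, α i ≠ 0) :
    ∑ i, C (diffCofactor α i) * ∏ j ∈ univ.erase i, (1 - C (α j) * X)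
      = C (diffProd α) * (X : F[X]) ^ (Fintype.card ι - 1) := by
  have hv : Set.InjOn (fun i => (α i)⁻¹) (univ : Finset ι) :=
    (inv_injective.comp hα).injOn
  have h := Lagrange.eq_interpolate (f := (X : F[X]) ^ (Fintype.card ι - 1)) hv (by
    rw [degree_X_pow, card_univ]
    exact_mod_cast Nat.sub_lt Fintype.card_pos one_pos)
  rw [h, Lagrange.interpolate_apply, mul_sum]
  refine sum_congr rfl fun i _ => ?_
  rw [← diffCofactor_mul α i, C_mul, mul_assoc]
  congr 1
  have hc : Fintype.card ι - 1 = #(univ.erase i) := by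
    rw [card_erase_of_mem (mem_univ i), card_univ]
  rw [Lagrange.basis, eval_pow, eval_X, hc, map_pow, map_prod, ← prod_const, ← prod_mul_distrib,
    ← prod_mul_distrib]
  refine prod_congr rfl fun j hj => ?_
  have hij : α i - α j ≠ 0 := sub_ne_zero.2 (hα.ne (ne_of_mem_erase hj).symm)
  have hinv : (α i)⁻¹ - (α j)⁻¹ = -(α i - α j) * (α i)⁻¹ * (α j)⁻¹ := by
    have := h0 i; have := h0 j
    field_simp
    ring
  have e1 : (α i - α j) * ((α i)⁻¹ * ((α i)⁻¹ - (α j)⁻¹)⁻¹) = - α j := by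
    have := h0 i; have := h0 j
    rw [hinv]
    field_simp
  rw [Lagrange.basisDivisor, ← mul_assoc, ← mul_assoc, mul_assoc (C _), ← C_mul, ← C_mul, e1,
    mul_sub, ← C_mul, neg_mul, mul_inv_cancel₀ (h0 j)]
  simp only [C_neg, C_1]
  ring

open Polynomial in
theorem sum_diffCofactor_mul_prod [Nonempty ι] {R : Type*} [CommRing R] [IsDomain R] {α : ι → R}
    (hα : Function.Injective α) (h0 : ∀ i, α i ≠ 0) :
    ∑ i, C (diffCofactor α i) * ∏ j ∈ univ.erase i, (1 - C (α j) * X)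
      = C (diffProd α) * (X : R[X]) ^ (Fintype.card ι - 1) := by
  have hinj := IsFractionRing.injective R (FractionRing R)
  apply Polynomial.map_injective _ hinj
  have := sum_diffCofactor_mul_prod_of_field (α := fun i => algebraMap R (FractionRing R) (α i))
    (hinj.comp hα) (fun i => by simpa using h0 i)
  simp only [← map_diffProd, ← map_diffCofactor] at this
  simpa [Polynomial.map_sum, Polynomial.map_prod] using this

/-- The generating series of the sums `∑_i α_iᵖ / ∏_{j ≠ i} (α_i - α_j)`. -/
theorem mk_sum_diffCofactor_mul_prod [Nonempty ι] {R : Type*} [CommRing R] [IsDomain R] {α : ι → R}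
    (hα : Function.Injective α) (h0 : ∀ i, α i ≠ 0) :
    (PowerSeries.mk fun p => ∑ i, diffCofactor α i * α i ^ p)
        * ∏ i, (1 - PowerSeries.C (α i) * PowerSeries.X)
      = PowerSeries.C (diffProd α) * PowerSeries.X ^ (Fintype.card ι - 1) := by
  have hgeom : ∀ a : R, PowerSeries.mk (fun p => a ^ p) * (1 - PowerSeries.C a * PowerSeries.X) = 1 := by
    intro a
    have := congrArg (PowerSeries.rescale a) (PowerSeries.mk_one_mul_one_sub_eq_one R)
    rw [map_mul, map_sub, map_one, PowerSeries.rescale_X, PowerSeries.rescale_mk] at this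
    simpa using! this
  have h := congrArg (Polynomial.coeToPowerSeries.ringHom) (sum_diffCofactor_mul_prod hα h0)
  simp only [map_sum, map_mul, map_prod, map_sub, map_one, map_pow,
    Polynomial.coeToPowerSeries.ringHom_apply, Polynomial.coe_C, Polynomial.coe_X] at h
  rw [← h]
  have hmk : (PowerSeries.mk fun p => ∑ i, diffCofactor α i * α i ^ p)
      = ∑ i, PowerSeries.C (diffCofactor α i) * PowerSeries.mk (fun p => α i ^ p) := by
    ext p
    simp
  rw [hmk, sum_mul]
  refine sum_congr rfl fun i _ => ?_
  rw [← mul_prod_erase univ _ (mem_univ i), mul_assoc, ← mul_assoc (PowerSeries.mk _), hgeom, one_mul]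

end Lagrange

end MKP

end

noncomputable section

namespace MKP

open MvPowerSeries Finset

set_option linter.unusedSectionVars false

variable {K : Type*} [Field K] [CharZero K]

/-! ### Algebraic independence of the power sums. -/

section PowerSums

/-- The values `∑_j [α_j]` of the times. -/
def bracketSum {σ ι : Type*} (s : Finset ι) (α : ι → MvPowerSeries σ K) : ℕ+ → MvPowerSeries σ K :=
  ∑ j ∈ s, bracket (α j)

theorem hasSubst_bracketSum {σ ι : Type*} (s : Finset ι) {α : ι → MvPowerSeries σ K}
    (hα : ∀ j, constantCoeff (α j) = 0) : HasSubst (bracketSum s α) :=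
  sum_mem (S := hasSubstIdeal) fun j _ => hasSubst_bracket (hα j)

theorem exists_sum_single_eq (ν : ℕ+ →₀ ℕ) :
    ∃ (r : ℕ) (m : Fin r → ℕ+), ν = ∑ q, Finsupp.single (m q) 1 := by
  induction ν using Finsupp.induction_linear with
  | zero => exact ⟨0, Fin.elim0, by simp⟩
  | add f g hf hg =>
    obtain ⟨r, m, rfl⟩ := hf
    obtain ⟨r', m', rfl⟩ := hg
    exact ⟨r + r', Fin.append m m', by simp [Fin.sum_univ_add]⟩
  | single n k => exact ⟨k, fun _ => n, by simp⟩

/-- Expanding the product of power sums chooses one variable `g q` for each factor `m q`. -/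
theorem coeff_prod_bracketSum {N r : ℕ} (m : Fin r → ℕ+) (e : Fin N →₀ ℕ) :
    coeff e ((∑ q, Finsupp.single (m q) 1).prod fun n k =>
        bracketSum univ (fun j => (X j : MvPowerSeries (Fin N) K)) n ^ k)
      = (∏ q, ((m q : ℕ) : K)⁻¹)
        * #{g : Fin r → Fin N | ∑ q, Finsupp.single (g q) (m q : ℕ) = e} := by
  classical
  have h1 : ((∑ q, Finsupp.single (m q) 1).prod fun n k =>
        bracketSum univ (fun j => (X j : MvPowerSeries (Fin N) K)) n ^ k)
      = ∏ q, bracketSum univ (fun j => (X j : MvPowerSeries (Fin N) K)) (m q) := by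
    rw [← Finsupp.prod_finsetSum_index (by simp) (by intros; rw [pow_add])]
    simp
  have h2 : ∀ g : Fin r → Fin N,
      (∏ q, bracket (X (g q) : MvPowerSeries (Fin N) K) (m q))
        = monomial (∑ q, Finsupp.single (g q) (m q : ℕ)) (∏ q, ((m q : ℕ) : K)⁻¹) := by
    intro g
    rw [← prod_monomial]
    refine prod_congr rfl fun q _ => ?_
    rw [bracket, X_pow_eq, ← map_smul]
    simp
  rw [h1]
  simp only [bracketSum, Finset.sum_apply]
  rw [prod_univ_sum]
  simp only [Fintype.piFinset_univ, h2, map_sum, coeff_monomial]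
  rw [← sum_filter]
  simp only [sum_const, nsmul_eq_mul, eq_comm, mul_comm]

/-- The map `g` groups the parts `m'` into blocks with sums `m j`. No block is empty since `m j >
0`, so with `r' ≤ r` the map is a bijection and `m'` is a rearrangement of `m`. -/
theorem eq_of_sum_single_eq {r r' : ℕ} (m : Fin r → ℕ+) (m' : Fin r' → ℕ+) (hr : r' ≤ r)
    (g : Fin r' → Fin r)
    (hg : ∑ q, Finsupp.single (g q) (m' q : ℕ) = ∑ j, Finsupp.single j (m j : ℕ)) :
    ∑ q, Finsupp.single (m' q) 1 = ∑ q, Finsupp.single (m q) (1 : ℕ) := by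
  classical
  have hval : ∀ j, ∑ q, (if g q = j then (m' q : ℕ) else 0) = m j := by
    intro j
    have := DFunLike.congr_fun hg j
    simpa [Finsupp.finsetSum_apply, Finsupp.single_apply] using this
  have hsurj : Function.Surjective g := by
    intro j
    by_contra! h
    have := hval j
    rw [sum_eq_zero fun q _ => if_neg (h q)] at this
    exact (m j).ne_zero this.symm
  have hcard : r' = r := by
    have := Fintype.card_le_of_surjective g hsurj
    simp only [Fintype.card_fin] at this
    omega
  subst hcard
  have hinj : Function.Injective g := Finite.injective_iff_surjective.2 hsurj
  have hm : ∀ q, m (g q) = m' q := by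
    intro q
    have := hval (g q)
    rw [sum_eq_single q (fun q' _ hq' => if_neg (hinj.ne hq')) (by simp), if_pos rfl] at this
    exact (PNat.coe_injective this).symm
  simp only [← hm]
  exact Equiv.sum_comp (Equiv.ofBijective g ⟨hinj, hsurj⟩) fun q => Finsupp.single (m q) 1

/-- A series that vanishes at `[α_1] + ⋯ + [α_N]` for every `N` is zero. -/
theorem eq_zero_of_evalAt_bracketSum (f : TimeSeries K)
    (h : ∀ N : ℕ, evalAt f (bracketSum univ fun j => (X j : MvPowerSeries (Fin N) K)) = 0) :
    f = 0 := by
  classical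
  by_contra hf
  obtain ⟨ν₀, hν₀⟩ : ∃ ν, coeff ν f ≠ 0 := by
    by_contra! h0
    exact hf (MvPowerSeries.ext h0)
  obtain ⟨r₀, m₀, rfl⟩ := exists_sum_single_eq ν₀
  -- Among the monomials of `f` with the weight of `ν₀`, one with the largest number `r` of factors
  -- is chosen. The maximum exists because each factor has weight at least one.
  let P : ℕ → Prop := fun r => ∃ m : Fin r → ℕ+, coeff (∑ q, Finsupp.single (m q) 1) f ≠ 0 ∧
    ∑ q, (m q : ℕ) = ∑ q, (m₀ q : ℕ)
  have hP : ∀ r, P r → r ≤ ∑ q, (m₀ q : ℕ) := by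
    rintro r ⟨m, -, hm⟩
    rw [← hm]
    calc r = ∑ _q : Fin r, 1 := by simp
      _ ≤ _ := sum_le_sum fun q _ => (m q).pos
  have hP₀ : P r₀ := ⟨m₀, hν₀, rfl⟩
  obtain ⟨r, ⟨m, hm, hmw⟩, hmax⟩ : ∃ r, P r ∧ ∀ r', P r' → r' ≤ r :=
    ⟨_, Nat.findGreatest_spec (hP r₀ hP₀) hP₀, fun r' h' => Nat.le_findGreatest (hP r' h') h'⟩
  -- At `N = r` the coefficient of `∏ α_j ^ m_j` is tested. Another monomial contributing to it has
  -- the same weight, hence at most `r` factors, and so coincides with the chosen one.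
  have h1 := congrArg (coeff (∑ j, Finsupp.single j (m j : ℕ))) (h r)
  rw [coeff_subst (hasSubst_bracketSum _ fun j => constantCoeff_X j),
    finsum_eq_single _ (∑ q, Finsupp.single (m q) 1), coeff_prod_bracketSum, map_zero] at h1
  · refine smul_ne_zero hm (mul_ne_zero (prod_ne_zero_iff.2 fun q _ => ?_) ?_) h1
    · exact inv_ne_zero (by exact_mod_cast (m q).ne_zero)
    · have : (#{g : Fin r → Fin r | ∑ q, Finsupp.single (g q) (m q : ℕ)
          = ∑ j, Finsupp.single j (m j : ℕ)}) ≠ 0 :=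
        card_ne_zero_of_mem (a := id) (by simp)
      exact_mod_cast this
  · intro ν' hν'
    obtain ⟨r', m', rfl⟩ := exists_sum_single_eq ν'
    by_contra hne
    rw [coeff_prod_bracketSum] at hne
    have hc := left_ne_zero_of_smul hne
    have hcard := right_ne_zero_of_mul (right_ne_zero_of_smul hne)
    obtain ⟨g, hg⟩ := card_ne_zero.1 (by exact_mod_cast hcard)
    have hg := (mem_filter.1 hg).2
    refine hν' (eq_of_sum_single_eq m m' (hmax r' ⟨m', hc, ?_⟩) g hg)
    rw [← hmw]
    simpa [map_sum] using congrArg Finsupp.degree hg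

end PowerSums

end MKP

end

noncomputable section

namespace MKP

open MvPowerSeries Finset
open scoped MvPowerSeries.WithPiTopology

set_option linter.unusedSectionVars false

variable {K : Type*} [Field K] [CharZero K]

/-! ### The variables `λ` and `λ⁻¹`. -/

section Spectral

variable {σ : Type*}

instance : Finite Spectral :=
  Finite.of_surjective (fun b : Bool => if b then Spectral.lam else Spectral.lamInv) (by
    rintro (_ | _)
    · exact ⟨true, rfl⟩
    · exact ⟨false, rfl⟩)

/-- The exponent of `λᵃ (λ⁻¹)ᵇ`. -/
def spectralExponent (a b : ℕ) : Spectral →₀ ℕ :=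
  Finsupp.single Spectral.lam a + Finsupp.single Spectral.lamInv b

@[simp]
theorem spectralExponent_lam (a b : ℕ) : spectralExponent a b Spectral.lam = a := by
  simp [spectralExponent]

@[simp]
theorem spectralExponent_lamInv (a b : ℕ) : spectralExponent a b Spectral.lamInv = b := by
  simp [spectralExponent]

theorem spectralExponent_ext {e e' : Spectral →₀ ℕ} (h : e Spectral.lam = e' Spectral.lam)
    (h' : e Spectral.lamInv = e' Spectral.lamInv) : e = e' := by
  ext (_ | _)
  · exact h
  · exact h'

theorem spectralMonomial_eq (s : σ →₀ ℕ) (a b : ℕ) :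
    spectralMonomial s a b = s.sumElim (spectralExponent a b) := by
  ext (i | i)
  · rw [Finsupp.sumElim_inl, spectralMonomial]
    simp
  · rw [Finsupp.sumElim_inr, spectralMonomial, Finsupp.add_apply, Finsupp.add_apply,
      Finsupp.embDomain_of_notMem_range _ _ _ (by simp)]
    rcases i with _ | _ <;> simp

/-- Finiteness is essential: `finsum` takes the value zero on an infinite support. -/
theorem hasSum_residue [UniformSpace K] [DiscreteUniformity K] {F : MvPowerSeries (σ ⊕ Spectral) K}
    (hF : ∀ s, (Function.support fun a : ℕ => coeff (spectralMonomial s a (a + 1)) F).Finite) :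
    HasSum (fun a => slice (spectralExponent a (a + 1)) F) (residue F) := by
  rw [WithPiTopology.hasSum_iff_hasSum_coeff]
  intro s
  have h : coeff s (residue F) = ∑ a ∈ (hF s).toFinset, coeff (spectralMonomial s a (a + 1)) F :=
    finsum_eq_sum _ (hF s)
  rw [h]
  simp only [coeff_slice, ← spectralMonomial_eq]
  apply hasSum_sum_of_ne_finset_zero
  intro a ha
  simpa using ha

/-- The series obtained by setting `λ⁻¹ = 0`, as a power series in `λ`. -/
def lamSeries : MvPowerSeries (σ ⊕ Spectral) K →+* PowerSeries (MvPowerSeries σ K) where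
  toFun F := PowerSeries.mk fun a => slice (spectralExponent a 0) F
  map_zero' := by ext; simp
  map_add' F G := by ext; simp
  map_one' := by
    classical
    ext a s
    simp only [PowerSeries.coeff_mk, coeff_slice, coeff_one, PowerSeries.coeff_one]
    by_cases ha : a = 0
    · subst ha
      rw [if_pos rfl, coeff_one]
      congr 1
      simp [Finsupp.ext_iff, spectralExponent]
    · rw [if_neg ha, map_zero, if_neg]
      intro h
      have := DFunLike.congr_fun h (Sum.inr Spectral.lam)
      simp [ha] at this
  map_mul' F G := by
    classical
    ext1 a
    rw [PowerSeries.coeff_mul]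
    simp only [PowerSeries.coeff_mk, slice_mul]
    rw [spectralExponent, Finsupp.single_zero, add_zero, Finsupp.antidiagonal_single]
    simp [spectralExponent]

theorem coeff_lamSeries (F : MvPowerSeries (σ ⊕ Spectral) K) (a : ℕ) :
    PowerSeries.coeff a (lamSeries F) = slice (spectralExponent a 0) F :=
  PowerSeries.coeff_mk a fun a => slice (spectralExponent a 0) F

theorem lamSeries_inlSeries (h : MvPowerSeries σ K) : lamSeries (inlSeries h) = PowerSeries.C h := by
  classical
  ext a s
  rw [coeff_lamSeries, coeff_slice, coeff_inlSeries, PowerSeries.coeff_C]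
  by_cases ha : a = 0
  · subst ha
    simp [spectralExponent]
  · rw [if_neg ha, if_neg]
    · simp
    · intro h
      exact ha (by simpa using DFunLike.congr_fun h Spectral.lam)

theorem lamSeries_lam :
    lamSeries (X (Sum.inr Spectral.lam) : MvPowerSeries (σ ⊕ Spectral) K) = PowerSeries.X := by
  classical
  ext a s
  rw [coeff_lamSeries, coeff_slice, PowerSeries.coeff_X, coeff_X]
  by_cases ha : a = 1
  · subst ha
    rw [if_pos rfl, coeff_one]
    congr 1
    rw [← Finsupp.sumElim_zero_single, spectralExponent, Finsupp.single_zero, add_zero]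
    simp only [Finsupp.ext_iff, Sum.forall, Finsupp.sumElim_inl, Finsupp.sumElim_inr]
    simp
  · rw [if_neg ha, if_neg]
    · simp
    · intro h
      exact ha (by simpa using DFunLike.congr_fun h (Sum.inr Spectral.lam))

open Classical in
/-- The substitution that sets the spectral variable `v` to zero. -/
def killSpectral (σ K : Type*) [Field K] (v : Spectral) : σ ⊕ Spectral → MvPowerSeries (σ ⊕ Spectral) K :=
  Sum.elim (fun s => X (Sum.inl s)) (fun w => if w = v then 0 else X (Sum.inr w))

theorem hasSubst_killSpectral (v : Spectral) : HasSubst (killSpectral σ K v) :=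
  hasSubst_sumElim hasSubst_X_inl (hasSubst_of_constantCoeff_zero fun w => by split_ifs <;> simp)

/-- Being fixed by the substitution `v = 0` expresses that `F` does not involve `v`. -/
theorem slice_eq_zero_of_killSpectral {v : Spectral} {F : MvPowerSeries (σ ⊕ Spectral) K}
    (hF : subst (killSpectral σ K v) F = F) {e : Spectral →₀ ℕ} (he : e v ≠ 0) : slice e F = 0 := by
  classical
  let _ : UniformSpace K := ⊥
  have h := hasSum_slice (hasSubst_X_inl (σ := σ) (τ := Spectral) (K := K))
    (c := fun w => if w = v then 0 else X (Sum.inr w))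
    (hasSubst_of_constantCoeff_zero fun w => by split_ifs <;> simp) F
  rw [WithPiTopology.hasSum_iff_hasSum_coeff] at h
  ext s
  have hs := h (s.sumElim e)
  have hF' : subst (Sum.elim (fun s : σ => (X (Sum.inl s) : MvPowerSeries (σ ⊕ Spectral) K))
      (fun w => if w = v then 0 else X (Sum.inr w))) F = F := by
    convert hF using 2
    unfold killSpectral
    congr!
  rw [hF'] at hs
  refine hs.unique ?_
  convert! hasSum_zero with e'
  by_cases he' : e' v = 0
  · have : (e'.prod fun w k => (if w = v then 0 else X (Sum.inr w) : MvPowerSeries (σ ⊕ Spectral) K) ^ k)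
        = monomial (Finsupp.sumElim 0 e') 1 := by
      rw [monomial_one_eq, Finsupp.prod_sumElim]
      simp only [Finsupp.prod_zero_index, one_mul]
      refine Finsupp.prod_congr fun w hw => ?_
      rw [if_neg]
      · rfl
      · rintro rfl
        exact (Finsupp.mem_support_iff.1 hw) he'
    rw [this]
    change coeff (s.sumElim e) (inlSeries (slice e' F) * _) = 0
    rw [← coeff_slice, slice_inlSeries_mul_monomial, if_neg]
    · simp
    · rintro rfl
      exact he he'
  · have : (e'.prod fun w k => (if w = v then 0 else X (Sum.inr w) : MvPowerSeries (σ ⊕ Spectral) K) ^ k)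
        = 0 := by
      rw [Finsupp.prod]
      exact prod_eq_zero (Finsupp.mem_support_iff.2 he') (by simp [he'])
    rw [this, mul_zero, map_zero]

/-- As `F` is free of `λ⁻¹` and `G` is free of `λ`, only one splitting of the exponent contributes.
-/
theorem slice_mul_of_killSpectral {F G : MvPowerSeries (σ ⊕ Spectral) K}
    (hF : subst (killSpectral σ K Spectral.lamInv) F = F)
    (hG : subst (killSpectral σ K Spectral.lam) G = G) (a b : ℕ) :
    slice (spectralExponent a b) (F * G)
      = slice (spectralExponent a 0) F * slice (spectralExponent 0 b) G := by
  classical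
  rw [slice_mul, sum_eq_single (spectralExponent a 0, spectralExponent 0 b)]
  · rintro ⟨p, q⟩ hpq hne
    rw [HasAntidiagonal.mem_antidiagonal] at hpq
    by_cases hp : p Spectral.lamInv = 0
    · by_cases hq : q Spectral.lam = 0
      · refine absurd (Prod.ext ?_ ?_) hne
        · apply spectralExponent_ext
          · simpa [hq] using DFunLike.congr_fun hpq Spectral.lam
          · simpa using hp
        · apply spectralExponent_ext
          · simpa using hq
          · simpa [hp] using DFunLike.congr_fun hpq Spectral.lamInv
      · rw [slice_eq_zero_of_killSpectral hG hq, mul_zero]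
    · rw [slice_eq_zero_of_killSpectral hF hp, zero_mul]
  · intro h
    refine absurd (HasAntidiagonal.mem_antidiagonal.2 ?_) h
    simp [spectralExponent]

/-- The substitution `λ = 0`, `λ⁻¹ = a`. -/
def spectralEval (a : MvPowerSeries σ K) : σ ⊕ Spectral → MvPowerSeries σ K :=
  Sum.elim X (fun | Spectral.lam => 0 | Spectral.lamInv => a)

theorem hasSubst_spectralEval {a : MvPowerSeries σ K} (ha : constantCoeff a = 0) :
    HasSubst (spectralEval a) :=
  hasSubst_sumElim HasSubst.X (hasSubst_of_constantCoeff_zero fun w => by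
    rcases w with _ | _
    · simp
    · exact ha)

theorem hasSum_spectralEval [UniformSpace K] [DiscreteUniformity K] {a : MvPowerSeries σ K}
    (ha : constantCoeff a = 0) (F : MvPowerSeries (σ ⊕ Spectral) K) :
    HasSum (fun m => slice (spectralExponent 0 m) F * a ^ m) (subst (spectralEval a) F) := by
  have h := hasSum_slice (K := K) (σ := σ) HasSubst.X
    (c := fun | Spectral.lam => 0 | Spectral.lamInv => a)
    (hasSubst_of_constantCoeff_zero fun w => by
      rcases w with _ | _
      · simp
      · exact ha) F
  have hinj : Function.Injective (spectralExponent 0) := fun m m' h => by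
    simpa using DFunLike.congr_fun h Spectral.lamInv
  rw [← hinj.hasSum_iff] at h
  · convert! h using 2 with m
    simp [spectralExponent, subst_self]
  · intro e he
    have hlam : e Spectral.lam ≠ 0 := by
      intro h0
      exact he ⟨e Spectral.lamInv, spectralExponent_ext (by simpa using h0.symm) (by simp)⟩
    rw [Finsupp.prod, prod_eq_zero (Finsupp.mem_support_iff.2 hlam) (by simp [hlam]), mul_zero]

end Spectral

end MKP

end

noncomputable section

namespace MKP

open MvPowerSeries Finset
open scoped MvPowerSeries.WithPiTopology

set_option linter.unusedSectionVars false

variable {K : Type*} [Field K] [CharZero K]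

/-! ### Miwa variables and density of the Miwa points. -/

section Miwa

variable {σ υ ι : Type*}

theorem hasSubst_sub {a b : σ → MvPowerSeries υ K} (ha : HasSubst a) (hb : HasSubst b) :
    HasSubst (a - b) := by
  rw [sub_eq_add_neg]
  exact ha.add ⟨fun n => by simpa using hb.const_coeff n, fun d => by simpa using hb.coeff_zero d⟩

theorem subst_bracket {a : σ → MvPowerSeries υ K} (ha : HasSubst a) (α : MvPowerSeries σ K) (n : ℕ+) :
    subst a (bracket α n) = bracket (subst a α) n := by
  rw [bracket, bracket, subst_smul ha, subst_pow ha]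

theorem subst_bracketSum {a : σ → MvPowerSeries υ K} (ha : HasSubst a) (s : Finset ι)
    (α : ι → MvPowerSeries σ K) (n : ℕ+) :
    subst a (bracketSum s α n) = bracketSum s (fun j => subst a (α j)) n := by
  rw [bracketSum, bracketSum, Finset.sum_apply, Finset.sum_apply, ← coe_substAlgHom (R := K) ha,
    map_sum]
  simp only [coe_substAlgHom, subst_bracket ha]

instance : IsDomain (MvPowerSeries σ K) := NoZeroDivisors.to_isDomain _

/-- Formal power series in `x = (xₙ)` and the Miwa variables `α_i`. -/
abbrev MiwaRing (K ι : Type*) := MvPowerSeries (ℕ+ ⊕ ι) K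

/-- The variables `xₙ`. -/
def miwaX (K ι : Type*) [Field K] : ℕ+ → MiwaRing K ι := fun n => X (Sum.inl n)

/-- The variables `α_i`. -/
def miwaVar (K : Type*) {ι : Type*} [Field K] (i : ι) : MiwaRing K ι := X (Sum.inr i)

theorem hasSubst_miwaX : HasSubst (miwaX K ι) := hasSubst_X_inl

@[simp]
theorem constantCoeff_miwaVar (i : ι) : constantCoeff (miwaVar K i) = 0 := constantCoeff_X _

theorem miwaVar_injective : Function.Injective (miwaVar K : ι → MiwaRing K ι) := fun _ _ h =>
  Sum.inr_injective (X_inj.1 h)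

theorem miwaVar_ne_zero (i : ι) : miwaVar K i ≠ 0 := fun h => by
  simpa [miwaVar] using congrArg (coeff (Finsupp.single (Sum.inr i) 1)) h

theorem hasSubst_miwaShift (s : Finset ι) : HasSubst (miwaX K ι + bracketSum s (miwaVar K)) :=
  hasSubst_miwaX.add (hasSubst_bracketSum s constantCoeff_miwaVar)

/-- `τ(x + ∑_{i ∈ s} [α_i])`. -/
def miwaShift (τ : TimeSeries K) (s : Finset ι) : MiwaRing K ι :=
  evalAt τ (miwaX K ι + bracketSum s (miwaVar K))

theorem subst_miwaShift {a : ℕ+ ⊕ ι → MvPowerSeries υ K} (ha : HasSubst a) (τ : TimeSeries K)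
    (s : Finset ι) : subst a (miwaShift τ s)
      = evalAt τ ((fun n => a (Sum.inl n)) + bracketSum s (fun i => a (Sum.inr i))) := by
  rw [miwaShift, subst_comp_subst_apply (hasSubst_miwaShift s) ha]
  congr 1
  funext n
  rw [Pi.add_apply, Pi.add_apply, subst_add ha, subst_bracketSum ha, miwaX, subst_X ha]
  simp only [miwaVar, subst_X ha]

/-- Setting all `α_i` and no `xₙ` to zero recovers `τ`. -/
theorem miwaShift_ne_zero {τ : TimeSeries K} (hτ : τ ≠ 0) (s : Finset ι) : miwaShift τ s ≠ 0 := by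
  intro h
  have ha : HasSubst (Sum.elim X (fun _ => 0) : ℕ+ ⊕ ι → TimeSeries K) :=
    hasSubst_sumElim HasSubst.X HasSubst.zero
  have h1 := congrArg (subst (Sum.elim X (fun _ => 0) : ℕ+ ⊕ ι → TimeSeries K)) h
  rw [subst_miwaShift ha, ← coe_substAlgHom (R := K) ha, map_zero] at h1
  apply hτ
  rw [← h1]
  have h2 : ((fun n => Sum.elim X (fun _ => 0) (Sum.inl n : ℕ+ ⊕ ι))
      + bracketSum s (fun i => Sum.elim X (fun _ => 0) (Sum.inr i : ℕ+ ⊕ ι)) : ℕ+ → TimeSeries K) = X := by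
    funext n
    simp [bracketSum, bracket]
  rw [h2]
  exact (congrFun subst_self τ).symm

variable [Fintype ι]

/-- The values `t = x`, `t' = x + ∑_i [α_i]`. -/
def miwaArg (K ι : Type*) [Field K] [Fintype ι] : ℕ+ ⊕ ℕ+ → MiwaRing K ι :=
  Sum.elim (miwaX K ι) (miwaX K ι + bracketSum univ (miwaVar K))

theorem hasSubst_miwaArg : HasSubst (miwaArg K ι) :=
  hasSubst_sumElim hasSubst_miwaX (hasSubst_miwaShift univ)

/-- A series in `t` and `t'` that vanishes at `t' = t + [α_1] + ⋯ + [α_N]` for every `N` is zero. -/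
theorem eq_zero_of_subst_miwaArg (Ψ : MvPowerSeries (ℕ+ ⊕ ℕ+) K)
    (h : ∀ N : ℕ, subst (miwaArg K (Fin N)) Ψ = 0) : Ψ = 0 := by
  -- The change of variables `t' = t + u`, with `u` on the left and `t` on the right summand; `hw`
  -- below is its inverse.
  have hv : HasSubst (Sum.elim (fun n => X (Sum.inr n)) (fun n => X (Sum.inr n) + X (Sum.inl n)) :
      ℕ+ ⊕ ℕ+ → MvPowerSeries (ℕ+ ⊕ ℕ+) K) :=
    hasSubst_sumElim hasSubst_X_inr (hasSubst_X_inr.add hasSubst_X_inl)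
  have hw : HasSubst (Sum.elim (fun n => X (Sum.inr n) - X (Sum.inl n)) (fun n => X (Sum.inl n)) :
      ℕ+ ⊕ ℕ+ → MvPowerSeries (ℕ+ ⊕ ℕ+) K) :=
    hasSubst_sumElim (hasSubst_sub hasSubst_X_inr hasSubst_X_inl) hasSubst_X_inl
  have hzero : subst (Sum.elim (fun n => X (Sum.inr n)) (fun n => X (Sum.inr n) + X (Sum.inl n)) :
      ℕ+ ⊕ ℕ+ → MvPowerSeries (ℕ+ ⊕ ℕ+) K) Ψ = 0 := by
    -- Each coefficient with respect to `t` is a series in `u` alone, to which the independence of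
    -- power sums applies.
    apply ext_slice
    intro e
    rw [slice_zero]
    apply eq_zero_of_evalAt_bracketSum
    intro N
    have hp := hasSubst_bracketSum univ (fun j : Fin N => constantCoeff_X (R := K) j)
    have hp' := hasSubst_sumElim (hasSubst_inlSeries (τ := ℕ+) hp)
      (hasSubst_X_inr (σ := Fin N) (τ := ℕ+) (K := K))
    have hs : HasSubst (Sum.elim (fun n => X (Sum.inr n)) (fun j => X (Sum.inl j)) :
        ℕ+ ⊕ Fin N → MvPowerSeries (Fin N ⊕ ℕ+) K) :=
      hasSubst_sumElim hasSubst_X_inr hasSubst_X_inl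
    change subst (bracketSum univ X) _ = 0
    rw [← slice_subst hp, subst_comp_subst_apply hv hp']
    have := congrArg (subst (Sum.elim (fun n => X (Sum.inr n)) (fun j => X (Sum.inl j)) :
        ℕ+ ⊕ Fin N → MvPowerSeries (Fin N ⊕ ℕ+) K)) (h N)
    rw [subst_comp_subst_apply hasSubst_miwaArg hs, ← coe_substAlgHom (R := K) hs, map_zero,
      coe_substAlgHom] at this
    refine Eq.trans (congrArg (slice e) ?_) (slice_zero e)
    rw [← this]
    congr 1
    funext v
    rcases v with n | n
    · simp only [Sum.elim_inl, miwaArg, miwaX]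
      rw [subst_X hp', subst_X hs]
      rfl
    · simp only [Sum.elim_inr, miwaArg, miwaX, Pi.add_apply]
      rw [subst_add hp', subst_add hs, subst_X hp', subst_X hp', subst_X hs, subst_bracketSum hs]
      simp only [Sum.elim_inl, Sum.elim_inr, inlSeries, miwaVar]
      rw [subst_bracketSum hasSubst_X_inl]
      simp only [subst_X hasSubst_X_inl, subst_X hs, Sum.elim_inr]
  have h1 := congrArg (subst (Sum.elim (fun n => X (Sum.inr n) - X (Sum.inl n))
    (fun n => X (Sum.inl n)) : ℕ+ ⊕ ℕ+ → MvPowerSeries (ℕ+ ⊕ ℕ+) K)) hzero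
  rw [subst_comp_subst_apply hv hw, ← coe_substAlgHom (R := K) hw, map_zero, coe_substAlgHom] at h1
  rw [← h1]
  conv_lhs => rw [← id_eq Ψ, ← subst_self]
  congr 1
  funext v
  rcases v with n | n
  · simp only [Sum.elim_inl]
    rw [subst_X hw]; rfl
  · simp only [Sum.elim_inr]
    rw [subst_add hw, subst_X hw, subst_X hw]
    simp

/-- The substitution `α_j = 0` for `j` in the second summand. -/
def forgetVars (K ι κ : Type*) [Field K] : ℕ+ ⊕ (ι ⊕ κ) → MiwaRing K ι :=
  Sum.elim (miwaX K ι) (Sum.elim (miwaVar K) fun _ => 0)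

theorem hasSubst_forgetVars {κ : Type*} [Fintype κ] : HasSubst (forgetVars K ι κ) :=
  hasSubst_sumElim hasSubst_miwaX (hasSubst_of_constantCoeff_zero (by rintro (_ | _) <;> simp))

theorem subst_forgetVars_miwaArg {κ : Type*} [Fintype κ] (Ψ : MvPowerSeries (ℕ+ ⊕ ℕ+) K) :
    subst (forgetVars K ι κ) (subst (miwaArg K (ι ⊕ κ)) Ψ) = subst (miwaArg K ι) Ψ := by
  rw [subst_comp_subst_apply hasSubst_miwaArg hasSubst_forgetVars]
  congr 1
  funext v
  rcases v with n | n
  · simp only [Sum.elim_inl, miwaArg, miwaX]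
    rw [subst_X hasSubst_forgetVars]; rfl
  · simp only [Sum.elim_inr, miwaArg, miwaX, Pi.add_apply]
    rw [subst_add hasSubst_forgetVars, subst_X hasSubst_forgetVars,
      subst_bracketSum hasSubst_forgetVars]
    simp only [miwaVar, subst_X hasSubst_forgetVars]
    simp [bracketSum, forgetVars, bracket, miwaX, miwaVar]

end Miwa

end MKP

end

noncomputable section

namespace MKP

open MvPowerSeries Finset
open scoped MvPowerSeries.WithPiTopology

set_option linter.unusedSectionVars false

variable {K : Type*} [Field K] [CharZero K]

/-! ### The residue at a Miwa point. -/

section Residue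

variable {σ υ ι : Type*}

theorem hasSum_powerSeriesSubst [UniformSpace K] [DiscreteUniformity K] {y : MvPowerSeries σ K}
    (hy : PowerSeries.HasSubst y) (p : PowerSeries K) :
    HasSum (fun n => PowerSeries.coeff n p • y ^ n) (p.subst y) := by
  rw [WithPiTopology.hasSum_iff_hasSum_coeff]
  intro m
  have hfin := PowerSeries.coeff_subst_finite hy p m
  rw [PowerSeries.coeff_subst hy, finsum_eq_sum _ hfin]
  simp only [map_smul]
  apply hasSum_sum_of_ne_finset_zero
  intro n hn
  simpa [or_iff_not_imp_left] using hn

theorem hasSum_negLog [UniformSpace K] [DiscreteUniformity K] {y : MvPowerSeries σ K}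
    (hy : PowerSeries.HasSubst y) :
    HasSum (fun n : ℕ+ => bracket y n) ((negLog K).subst y) := by
  have h := hasSum_powerSeriesSubst hy (negLog K)
  rw [← PNat.coe_injective.hasSum_iff] at h
  · convert! h using 2 with n
    simp [negLog, bracket]
  · intro n hn
    have : n = 0 := by
      by_contra h0
      exact hn ⟨⟨n, Nat.pos_of_ne_zero h0⟩, rfl⟩
    simp [this, negLog]

theorem hasSum_xi [UniformSpace K] [DiscreteUniformity K] (a : ℕ+ → BilinearRing K) :
    HasSum (fun n : ℕ+ => a n * lam ^ (n : ℕ)) (xi a) := by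
  rw [WithPiTopology.hasSum_iff_hasSum_coeff]
  intro m
  have hfin := xi_finite a m
  change HasSum _ (∑ᶠ n : ℕ+, coeff m (a n * lam ^ (n : ℕ)))
  rw [finsum_eq_sum _ hfin]
  apply hasSum_sum_of_ne_finset_zero
  intro n hn
  simpa using hn

theorem subst_killSpectral_inlSeries (v : Spectral) (h : MvPowerSeries σ K) :
    subst (killSpectral σ K v) (inlSeries h) = inlSeries h :=
  subst_inlSeries hasSubst_X_inl (hasSubst_of_constantCoeff_zero fun w => by split_ifs <;> simp) h

theorem subst_killSpectral_X {v w : Spectral} (hvw : w ≠ v) :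
    subst (killSpectral σ K v) (X (Sum.inr w) : MvPowerSeries (σ ⊕ Spectral) K) = X (Sum.inr w) := by
  rw [subst_X (hasSubst_killSpectral v)]
  simp [killSpectral, hvw]

theorem subst_spectralEval_inlSeries {a : MvPowerSeries σ K} (ha : constantCoeff a = 0)
    (h : MvPowerSeries σ K) : subst (spectralEval a) (inlSeries h) = h := by
  rw [spectralEval, subst_inlSeries HasSubst.X (hasSubst_of_constantCoeff_zero fun w => by
    rcases w with _ | _
    · simp
    · exact ha), subst_self]
  rfl

theorem subst_spectralEval_lamInv {a : MvPowerSeries σ K} (ha : constantCoeff a = 0) :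
    subst (spectralEval a) (X (Sum.inr Spectral.lamInv) : MvPowerSeries (σ ⊕ Spectral) K) = a := by
  rw [subst_X (hasSubst_spectralEval ha)]
  rfl

variable [Fintype ι]

/-- The substitution `t = x`, `t' = x + ∑_i [α_i]` that keeps `λ` and `λ⁻¹`. -/
def miwaLift (K ι : Type*) [Field K] [Fintype ι] :
    (ℕ+ ⊕ ℕ+) ⊕ Spectral → MvPowerSeries ((ℕ+ ⊕ ι) ⊕ Spectral) K :=
  Sum.elim (fun v => inlSeries (miwaArg K ι v)) (fun w => X (Sum.inr w))

theorem hasSubst_miwaLift : HasSubst (miwaLift K ι) :=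
  hasSubst_sumElim (hasSubst_inlSeries hasSubst_miwaArg) hasSubst_X_inr

theorem slice_subst_miwaLift (e : Spectral →₀ ℕ) (F : BilinearRing K) :
    slice e (subst (miwaLift K ι) F) = subst (miwaArg K ι) (slice e F) :=
  slice_subst hasSubst_miwaArg e F

theorem inlSeries_add (f g : MvPowerSeries σ K) :
    (inlSeries (f + g) : MvPowerSeries (σ ⊕ υ) K) = inlSeries f + inlSeries g :=
  subst_add hasSubst_X_inl f g

theorem inlSeries_bracketSum (s : Finset ι) (α : ι → MvPowerSeries σ K) (n : ℕ+) :
    (inlSeries (bracketSum s α n) : MvPowerSeries (σ ⊕ υ) K)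
      = bracketSum s (fun i => inlSeries (α i)) n :=
  subst_bracketSum hasSubst_X_inl s α n

/-- The series `α_i λ`. -/
def miwaLam (K : Type*) [Field K] (i : ι) : MvPowerSeries ((ℕ+ ⊕ ι) ⊕ Spectral) K :=
  inlSeries (miwaVar K i) * X (Sum.inr Spectral.lam)

theorem hasSubst_miwaLam (i : ι) : PowerSeries.HasSubst (miwaLam K i) :=
  PowerSeries.HasSubst.of_constantCoeff_zero (by simp [miwaLam])

theorem bracket_mul (a b : MvPowerSeries σ K) (n : ℕ+) :
    bracket (a * b) n = bracket a n * b ^ (n : ℕ) := by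
  rw [bracket, bracket, mul_pow, smul_mul_assoc]

theorem subst_miwaLift_xi :
    subst (miwaLift K ι) (xi (tvar' - tvar : ℕ+ → BilinearRing K)) = ∑ i, (negLog K).subst (miwaLam K i) := by
  let _ : UniformSpace K := ⊥
  have h1 := hasSum_map_subst (hasSubst_miwaLift (K := K) (ι := ι)) 
    (hasSum_xi (tvar' - tvar : ℕ+ → BilinearRing K))
  have h2 := hasSum_sum (s := (univ : Finset ι)) fun i _ => hasSum_negLog (hasSubst_miwaLam (K := K) i)
  refine h1.unique ?_
  convert h2 using 2 with n
  rw [subst_mul hasSubst_miwaLift, subst_pow hasSubst_miwaLift, Pi.sub_apply,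
    subst_sub hasSubst_miwaLift, lam, tvar, tvar', subst_X hasSubst_miwaLift,
    subst_X hasSubst_miwaLift, subst_X hasSubst_miwaLift]
  simp only [miwaLift, Sum.elim_inl, Sum.elim_inr, miwaArg, Pi.add_apply, inlSeries_add,
    inlSeries_bracketSum, add_sub_cancel_left, miwaLam, bracket_mul, ← sum_mul]
  rw [bracketSum, Finset.sum_apply]

/-- The image of `e^{ξ(t'-t,λ)}`. -/
def miwaExp (K ι : Type*) [Field K] [CharZero K] [Fintype ι] : MvPowerSeries ((ℕ+ ⊕ ι) ⊕ Spectral) K :=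
  formalExp (∑ i : ι, (negLog K).subst (miwaLam K i))

theorem hasSubst_negLog_miwaLam (i : ι) :
    PowerSeries.HasSubst ((negLog K).subst (miwaLam K i)) := by
  have := (hasSubst_negLog (K := K)).comp (hasSubst_miwaLam (K := K) i)
  rwa [PowerSeries.coe_substAlgHom] at this

theorem miwaExp_eq_prod : miwaExp K ι = ∏ i, formalExp ((negLog K).subst (miwaLam K i)) :=
  formalExp_sum _ _ hasSubst_negLog_miwaLam

theorem miwaExp_mul_prod : miwaExp K ι * ∏ i, (1 - miwaLam K i) = 1 := by
  rw [miwaExp_eq_prod, ← prod_mul_distrib]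
  exact prod_eq_one fun i _ => formalExp_negLog_mul (hasSubst_miwaLam i)

theorem subst_formalExp {a : σ → MvPowerSeries υ K} (ha : HasSubst a)
    {f : MvPowerSeries σ K} (hf : PowerSeries.HasSubst f) :
    subst a (formalExp f) = formalExp (subst a f) :=
  subst_powerSeriesSubst ha hf _

theorem subst_killSpectral_miwaExp :
    subst (killSpectral _ K Spectral.lamInv) (miwaExp K ι) = miwaExp K ι := by
  have hk := hasSubst_killSpectral (σ := ℕ+ ⊕ ι) (K := K) Spectral.lamInv
  rw [miwaExp_eq_prod, ← coe_substAlgHom (R := K) hk, map_prod]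
  refine prod_congr rfl fun i _ => ?_
  rw [coe_substAlgHom, subst_formalExp hk (hasSubst_negLog_miwaLam i),
    subst_powerSeriesSubst hk (hasSubst_miwaLam i), miwaLam, subst_mul hk,
    subst_killSpectral_inlSeries, subst_killSpectral_X (by simp)]

/-- Thus `lamSeries (miwaExp K ι)` is the generating series of the complete symmetric functions of
the `α_i`. -/
theorem lamSeries_miwaExp_mul_prod :
    lamSeries (miwaExp K ι) * ∏ i, (1 - PowerSeries.C (miwaVar K i) * PowerSeries.X) = 1 := by
  have := congrArg lamSeries (miwaExp_mul_prod (K := K) (ι := ι))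
  simpa [map_prod, miwaLam, lamSeries_inlSeries, lamSeries_lam] using this

/-- The image of `τ(t' - [λ⁻¹])`. -/
def miwaLower (ι : Type*) [Fintype ι] (τ : TimeSeries K) : MvPowerSeries ((ℕ+ ⊕ ι) ⊕ Spectral) K :=
  evalAt τ ((fun n => inlSeries ((miwaX K ι + bracketSum univ (miwaVar K) : ℕ+ → MiwaRing K ι) n))
    - bracket (X (Sum.inr Spectral.lamInv)))

/-- The image of `ρ(t + [λ⁻¹])`. -/
def miwaRaise (ι : Type*) (ρ : TimeSeries K) : MvPowerSeries ((ℕ+ ⊕ ι) ⊕ Spectral) K :=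
  evalAt ρ ((fun n => inlSeries (miwaX K ι n)) + bracket (X (Sum.inr Spectral.lamInv)))

theorem hasSubst_miwaLower : HasSubst ((fun n => inlSeries ((miwaX K ι + bracketSum univ (miwaVar K) : ℕ+ → MiwaRing K ι) n))
    - bracket (X (Sum.inr Spectral.lamInv) : MvPowerSeries ((ℕ+ ⊕ ι) ⊕ Spectral) K)) :=
  hasSubst_sub (hasSubst_inlSeries (hasSubst_miwaShift univ)) (hasSubst_bracket (by simp))

theorem hasSubst_miwaRaise : HasSubst ((fun n => inlSeries (miwaX K ι n))
    + bracket (X (Sum.inr Spectral.lamInv) : MvPowerSeries ((ℕ+ ⊕ ι) ⊕ Spectral) K)) :=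
  (hasSubst_inlSeries hasSubst_miwaX).add (hasSubst_bracket (by simp))

theorem subst_miwaLift_integrand (k : ℕ) (τ ρ : TimeSeries K) :
    subst (miwaLift K ι) (integrand k τ ρ)
      = (miwaExp K ι * X (Sum.inr Spectral.lam) ^ k) * (miwaLower ι τ * miwaRaise ι ρ) := by
  have hl := hasSubst_miwaLift (K := K) (ι := ι)
  have hxi : PowerSeries.HasSubst (xi (tvar' - tvar : ℕ+ → BilinearRing K)) := hasSubst_xi _
  have e1 : subst (miwaLift K ι) (evalAt τ (tvar' - bracket lamInv)) = miwaLower ι τ := by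
    rw [evalAt, subst_comp_subst_apply hasSubst_tvar'_sub hl, miwaLower]
    congr 1
    funext n
    rw [Pi.sub_apply, Pi.sub_apply, subst_sub hl, subst_bracket hl, tvar', lamInv, subst_X hl,
      subst_X hl]
    rfl
  have e2 : subst (miwaLift K ι) (evalAt ρ (tvar + bracket lamInv)) = miwaRaise ι ρ := by
    rw [subst_comp_subst_apply hasSubst_tvar_add hl, miwaRaise]
    congr 1
    funext n
    rw [Pi.add_apply, Pi.add_apply, subst_add hl, subst_bracket hl, tvar, lamInv, subst_X hl,
      subst_X hl]
    rfl
  rw [integrand, subst_mul hl, subst_mul hl, subst_mul hl, subst_pow hl, e1, e2,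
    subst_formalExp hl hxi, subst_miwaLift_xi, lam, subst_X hl, miwaExp, mul_assoc, mul_assoc,
    mul_assoc]
  rfl

theorem subst_killSpectral_miwaLower_mul_miwaRaise (τ ρ : TimeSeries K) :
    subst (killSpectral _ K Spectral.lam) (miwaLower ι τ * miwaRaise ι ρ)
      = miwaLower ι τ * miwaRaise ι ρ := by
  have hk := hasSubst_killSpectral (σ := ℕ+ ⊕ ι) (K := K) Spectral.lam
  rw [subst_mul hk]
  congr 1
  · rw [miwaLower, subst_comp_subst_apply hasSubst_miwaLower hk]
    congr 1
    funext n
    rw [Pi.sub_apply, subst_sub hk, subst_bracket hk, subst_killSpectral_inlSeries,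
      subst_killSpectral_X (by simp)]
  · rw [miwaRaise, subst_comp_subst_apply hasSubst_miwaRaise hk]
    congr 1
    funext n
    rw [Pi.add_apply, subst_add hk, subst_bracket hk, subst_killSpectral_inlSeries,
      subst_killSpectral_X (by simp)]

/-- The evaluation at the pole `λ = α_i⁻¹`: subtracting `[λ⁻¹]` removes `[α_i]` from the sum.
Setting `λ = 0` is harmless because `λ` does not occur. -/
theorem subst_spectralEval_miwaLower_mul_miwaRaise [DecidableEq ι] (τ ρ : TimeSeries K) (i : ι) :
    subst (spectralEval (miwaVar K i)) (miwaLower ι τ * miwaRaise ι ρ)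
      = miwaShift τ (univ.erase i) * miwaShift ρ {i} := by
  have ha := constantCoeff_miwaVar (K := K) i
  have hk := hasSubst_spectralEval ha
  rw [subst_mul hk]
  congr 1
  · rw [miwaLower, miwaShift, subst_comp_subst_apply hasSubst_miwaLower hk]
    congr 1
    funext n
    rw [Pi.sub_apply, subst_sub hk, subst_bracket hk, subst_spectralEval_inlSeries ha,
      subst_spectralEval_lamInv ha, bracketSum, bracketSum, ← add_sum_erase univ _ (mem_univ i)]
    simp only [Pi.add_apply]
    ring
  · rw [miwaRaise, miwaShift, subst_comp_subst_apply hasSubst_miwaRaise hk]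
    congr 1
    funext n
    rw [Pi.add_apply, subst_add hk, subst_bracket hk, subst_spectralEval_inlSeries ha,
      subst_spectralEval_lamInv ha, bracketSum, sum_singleton, Pi.add_apply]

variable [DecidableEq ι]

/-- The power sums weighted by the cofactors are the complete symmetric functions. -/
theorem sum_diffCofactor_mul_pow {k q : ℕ} (hN : Fintype.card ι = k + 2 + q) (p : ℕ) :
    ∑ i, diffCofactor (miwaVar K (ι := ι)) i * miwaVar K i ^ p
      = diffProd (miwaVar K (ι := ι)) * PowerSeries.coeff p
          (PowerSeries.X ^ (k + 1 + q) * lamSeries (miwaExp K ι)) := by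
  have : Nonempty ι := Fintype.card_pos_iff.1 (by omega)
  have h := mk_sum_diffCofactor_mul_prod (miwaVar_injective (K := K) (ι := ι)) miwaVar_ne_zero
  have h2 : (PowerSeries.mk fun p => ∑ i, diffCofactor (miwaVar K (ι := ι)) i * miwaVar K i ^ p)
      = PowerSeries.C (diffProd (miwaVar K (ι := ι)))
        * (PowerSeries.X ^ (k + 1 + q) * lamSeries (miwaExp K ι)) := by
    have h3 := lamSeries_miwaExp_mul_prod (K := K) (ι := ι)
    rw [show Fintype.card ι - 1 = k + 1 + q by omega] at h
    calc _ = (PowerSeries.mk fun p => ∑ i, diffCofactor (miwaVar K (ι := ι)) i * miwaVar K i ^ p)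
          * (lamSeries (miwaExp K ι)
            * ∏ i, (1 - PowerSeries.C (miwaVar K i) * PowerSeries.X)) := by rw [h3, mul_one]
      _ = _ := by
        rw [mul_comm (lamSeries _), ← mul_assoc, h, mul_assoc]
  have := congrArg (PowerSeries.coeff p) h2
  rwa [PowerSeries.coeff_mk, PowerSeries.coeff_C_mul] at this

/-- The residue of the bilinear equation at `t = x`, `t' = x + [α_1] + ⋯ + [α_N]`. -/
theorem diffProd_mul_subst_residue {k q : ℕ} (hN : Fintype.card ι = k + 2 + q) (τ ρ : TimeSeries K) :
    diffProd (miwaVar K (ι := ι)) * subst (miwaArg K ι) (residue (integrand k τ ρ))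
      = ∑ i, diffCofactor (miwaVar K) i * miwaVar K i ^ q
          * (miwaShift τ (univ.erase i) * miwaShift ρ {i}) := by
  let _ : UniformSpace K := ⊥
  set G : MvPowerSeries ((ℕ+ ⊕ ι) ⊕ Spectral) K := miwaLower ι τ * miwaRaise ι ρ with hG
  set V : ℕ → MiwaRing K ι := fun p => ∑ i, diffCofactor (miwaVar K) i * miwaVar K i ^ p with hV
  have hkill : subst (killSpectral _ K Spectral.lamInv)
      (miwaExp K ι * X (Sum.inr Spectral.lam) ^ k) = miwaExp K ι * X (Sum.inr Spectral.lam) ^ k := by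
    have hk := hasSubst_killSpectral (σ := ℕ+ ⊕ ι) (K := K) Spectral.lamInv
    rw [subst_mul hk, subst_pow hk, subst_killSpectral_miwaExp, subst_killSpectral_X (by simp)]
  -- The residue pairs the coefficient of `λ ^ a` in `λ ^ k ∏ (1 - α_i λ)⁻¹` with that of `(λ⁻¹) ^
  -- (a + 1)` in `G`; the former, times `diffProd`, is `V (q + (a + 1))`.
  have hslice : ∀ a, diffProd (miwaVar K (ι := ι)) * subst (miwaArg K ι)
      (slice (spectralExponent a (a + 1)) (integrand k τ ρ))
        = V (q + (a + 1)) * slice (spectralExponent 0 (a + 1)) G := by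
    intro a
    rw [← slice_subst_miwaLift, subst_miwaLift_integrand, slice_mul_of_killSpectral hkill
      (subst_killSpectral_miwaLower_mul_miwaRaise τ ρ), ← coeff_lamSeries, map_mul, map_pow,
      lamSeries_lam, hV, ← mul_assoc]
    congr 1
    simp only
    rw [sum_diffCofactor_mul_pow hN, show k + 1 + q = (q + 1) + k by ring,
      show q + (a + 1) = a + (q + 1) by ring, pow_add, mul_assoc,
      PowerSeries.coeff_X_pow_mul, mul_comm (lamSeries _)]
  -- The residue starts at the power `(λ⁻¹) ^ 1`, whereas evaluating `G` at `α_i` also includes the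
  -- constant term. That extra term carries the factor `V q`, which vanishes since `q < N - 1`.
  have hzero : V q = 0 := by
    rw [hV]
    simp only
    rw [sum_diffCofactor_mul_pow hN, PowerSeries.coeff_X_pow_mul', if_neg (by omega), mul_zero]
  have h1 := (hasSum_map_subst (hasSubst_miwaArg (ι := ι))
    (hasSum_residue (residue_integrand_finite k τ ρ))).mul_left (diffProd (miwaVar K (ι := ι)))
  simp only [hslice] at h1
  have h2 : HasSum (fun m => V (q + m) * slice (spectralExponent 0 m) G)
      (∑ i, diffCofactor (miwaVar K) i * miwaVar K i ^ q
          * (miwaShift τ (univ.erase i) * miwaShift ρ {i})) := by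
    have := hasSum_sum (s := (univ : Finset ι)) fun i _ =>
      (hasSum_spectralEval (constantCoeff_miwaVar (K := K) i) G).mul_left
        (diffCofactor (miwaVar K) i * miwaVar K i ^ q)
    simp only [hG, subst_spectralEval_miwaLower_mul_miwaRaise] at this
    convert! this using 2 with m
    rw [hV]
    simp only
    rw [sum_mul]
    refine sum_congr rfl fun i _ => ?_
    rw [pow_add]
    ring
  rw [← hasSum_nat_add_iff' 1] at h2
  refine h1.unique ?_
  convert! h2 using 1
  simp [hzero]

end Residue

end MKP

end

noncomputable section

namespace MKP

open MvPowerSeries Finset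

set_option linter.unusedSectionVars false

variable {K : Type*} [Field K] [CharZero K]

/-! ### The two implications. -/

section Equivalence

variable {ι : Type*}

/-- The three term equation at `x + ∑_{j ∈ A} [α_j]`. -/
theorem ThreeTermEquation.miwaShift_eq [DecidableEq ι] {τ : ℤ → TimeSeries K}
    (h : ThreeTermEquation τ) (l : ℤ) {A : Finset ι} {i a b : ι} (hi : i ∉ A) (ha : a ∉ A)
    (hb : b ∉ A) (hia : i ≠ a) (hib : i ≠ b) (hab : a ≠ b) :
    (miwaVar K a - miwaVar K b) * miwaShift (τ l) (insert i A)
        * miwaShift (τ (l + 1)) (insert a (insert b A))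
      - (miwaVar K i - miwaVar K b) * miwaShift (τ l) (insert a A)
        * miwaShift (τ (l + 1)) (insert i (insert b A))
      + (miwaVar K i - miwaVar K a) * miwaShift (τ l) (insert b A)
        * miwaShift (τ (l + 1)) (insert i (insert a A)) = 0 := by
  let c : Fin 3 → MiwaRing K ι := ![miwaVar K i, miwaVar K a, miwaVar K b]
  let f : ℕ+ ⊕ Fin 3 → MiwaRing K ι := Sum.elim (miwaX K ι + bracketSum A (miwaVar K)) c
  have hf : HasSubst f := hasSubst_sumElim (hasSubst_miwaShift A)
    (hasSubst_of_constantCoeff_zero fun j => by fin_cases j <;> simp [c])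
  have hx : ∀ n, subst f (xvar n : ThreeTermRing K) = miwaX K ι n + bracketSum A (miwaVar K) n :=
    fun n => subst_X hf _
  have hc : ∀ j, subst f (alpha j : ThreeTermRing K) = c j := fun j => subst_X hf _
  have e1 : ∀ (ρ : TimeSeries K) (j : Fin 3) (v : ι), c j = miwaVar K v → v ∉ A →
      subst f (evalAt ρ (xvar + bracket (alpha j))) = miwaShift ρ (insert v A) := by
    intro ρ j v hj hv
    rw [subst_comp_subst_apply (hasSubst_xvar_add j) hf, miwaShift]
    congr 1
    funext n
    rw [Pi.add_apply, subst_add hf, hx, subst_bracket hf, hc, hj, bracketSum, bracketSum,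
      sum_insert hv]
    simp only [Pi.add_apply]
    ring
  have e2 : ∀ (ρ : TimeSeries K) (j j' : Fin 3) (v v' : ι), c j = miwaVar K v → c j' = miwaVar K v' →
      v ∉ A → v' ∉ A → v ≠ v' → subst f (evalAt ρ (xvar + bracket (alpha j) + bracket (alpha j')))
        = miwaShift ρ (insert v (insert v' A)) := by
    intro ρ j j' v v' hj hj' hv hv' hvv'
    rw [subst_comp_subst_apply (hasSubst_xvar_add_add j j') hf, miwaShift]
    congr 1
    funext n
    rw [Pi.add_apply, Pi.add_apply, subst_add hf, subst_add hf, hx, subst_bracket hf,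
      subst_bracket hf, hc, hc, hj, hj', bracketSum, bracketSum, sum_insert (by simp [hvv', hv]),
      sum_insert hv']
    simp only [Pi.add_apply]
    ring
  have key := congrArg (subst f) (h l)
  rw [subst_add hf, subst_sub hf, subst_mul hf, subst_mul hf, subst_mul hf, subst_mul hf,
    subst_mul hf, subst_mul hf, subst_sub hf, subst_sub hf, subst_sub hf, hc, hc, hc,
    e1 _ 0 i rfl hi, e1 _ 1 a rfl ha, e1 _ 2 b rfl hb, e2 _ 1 2 a b rfl rfl ha hb hab,
    e2 _ 0 2 i b rfl rfl hi hb hib, e2 _ 0 1 i a rfl rfl hi ha hia,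
    ← coe_substAlgHom (R := K) hf, map_zero] at key
  exact key

/-- The family `S ↦ τ_{c + |S|}(x + ∑_{i ∈ S} [α_i])` in the field of fractions. -/
def miwaFamily (ι : Type*) (τ : ℤ → TimeSeries K) (c : ℤ) (S : Finset ι) :
    FractionRing (MiwaRing K ι) :=
  algebraMap (MiwaRing K ι) _ (miwaShift (τ (c + #S)) S)

theorem ThreeTermEquation.threeTermRelation [DecidableEq ι] {τ : ℤ → TimeSeries K}
    (h : ThreeTermEquation τ) (c : ℤ) :
    ThreeTermRelation (fun i => algebraMap (MiwaRing K ι) (FractionRing (MiwaRing K ι)) (miwaVar K i))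
      (miwaFamily ι τ c) := by
  intro A i a b hi ha hb hia hib hab
  have key := congrArg (algebraMap (MiwaRing K ι) (FractionRing (MiwaRing K ι)))
    (h.miwaShift_eq (c + #A + 1) hi ha hb hia hib hab)
  simp only [map_add, map_sub, map_mul, map_zero] at key
  have h1 : ∀ v, v ∉ A → (c + (#(insert v A) : ℕ) : ℤ) = c + #A + 1 := by
    intro v hv
    rw [card_insert_of_notMem hv]
    push_cast
    ring
  have h2 : ∀ v v', v ∉ A → v' ∉ A → v ≠ v' →
      (c + (#(insert v (insert v' A)) : ℕ) : ℤ) = c + #A + 1 + 1 := by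
    intro v v' hv hv' hvv'
    rw [card_insert_of_notMem (by simp [hvv', hv]), card_insert_of_notMem hv']
    push_cast
    ring
  simp only [miwaFamily, h1 i hi, h1 a ha, h1 b hb, h2 a b ha hb hab, h2 i b hi hb hib,
    h2 i a hi ha hia]
  exact key

variable [Fintype ι] [DecidableEq ι]

theorem ThreeTermEquation.sum_diffCofactor_mul_prod_eq_zero {τ : ℤ → TimeSeries K}
    (h : ThreeTermEquation τ) (hτ : ∀ l, τ l ≠ 0) {k q : ℕ} (hN : Fintype.card ι = k + 2 + q)
    {l l' : ℤ} (hl : l = l' + k) :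
    ∑ i, diffCofactor (fun i : ι => miwaVar K (Sum.inl i : ι ⊕ Fin q)) i
      * (∏ b : Fin q, (miwaVar K (Sum.inl i) - miwaVar K (Sum.inr b)))
      * (miwaShift (τ l) ((univ.erase i).map Function.Embedding.inl)
        * miwaShift (τ l') (insert (Sum.inl i) (univ.map Function.Embedding.inr))) = 0 := by
  set α : ι → MiwaRing K (ι ⊕ Fin q) := fun i => miwaVar K (Sum.inl i) with hαdef
  set φ := algebraMap (MiwaRing K (ι ⊕ Fin q)) (FractionRing (MiwaRing K (ι ⊕ Fin q))) with hφdef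
  have hφ : Function.Injective φ := IsFractionRing.injective _ _
  have hα : Function.Injective α := miwaVar_injective.comp Sum.inl_injective
  -- The offset `c = l' - q - 1` gives index `l` to the sets `S \ i` of size `k + 1 + q` and index
  -- `l'` to the sets `B ∪ i` of size `q + 1`.
  have hzero := (h.threeTermRelation (ι := ι ⊕ Fin q) (l' - q - 1)).exchangeSum_eq_zero
    (hφ.comp miwaVar_injective)
    (fun A => (map_ne_zero_iff _ hφ).2 (miwaShift_ne_zero (hτ _) A))
    (univ.map Function.Embedding.inl) (univ.map Function.Embedding.inr) (by simp [hN]; omega)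
  apply hφ
  rw [map_zero, map_sum, ← mul_zero (φ (diffProd α)), ← hzero, exchangeSum, mul_sum, sum_map]
  refine sum_congr rfl fun i _ => ?_
  have e0 : (univ.map Function.Embedding.inl).erase (Function.Embedding.inl i : ι ⊕ Fin q)
      = (univ.erase i).map Function.Embedding.inl := (map_erase _ _ _).symm
  have e1 : (l' - q - 1 + (#((univ.erase i).map
      (Function.Embedding.inl : ι ↪ ι ⊕ Fin q)) : ℕ) : ℤ) = l := by
    rw [card_map, card_erase_of_mem (mem_univ i), card_univ, hN,
      show k + 2 + q - 1 = k + 1 + q by omega]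
    push_cast
    omega
  have e2 : (l' - q - 1 + (#(insert (Function.Embedding.inl i)
      (univ.map (Function.Embedding.inr : Fin q ↪ ι ⊕ Fin q))) : ℕ) : ℤ) = l' := by
    rw [card_insert_of_notMem (by simp), card_map, card_univ, Fintype.card_fin]
    push_cast
    ring
  have e4 : φ (∏ j ∈ univ.erase i, (α i - α j)) ≠ 0 :=
    (map_ne_zero_iff _ hφ).2 (prod_ne_zero_iff.2 fun j hj =>
      sub_ne_zero.2 (hα.ne (ne_of_mem_erase hj).symm))
  have aux : ∀ c p d x y : FractionRing (MiwaRing K (ι ⊕ Fin q)), d ≠ 0 →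
      c * p * (x * y) = c * d * (p / d * x * y) := by
    intro c p d x y hd
    field_simp
  rw [e0, miwaFamily, miwaFamily, e1, e2, prod_map, prod_map, ← diffCofactor_mul α i,
    map_mul φ (diffCofactor α i) (∏ j ∈ univ.erase i, (α i - α j)), map_mul, map_mul, map_mul,
    aux _ _ _ _ _ e4, map_prod, map_prod]
  simp only [map_sub]
  rfl

theorem subst_forgetVars_miwaVar_inl {q : ℕ} (i : ι) :
    subst (forgetVars K ι (Fin q)) (miwaVar K (Sum.inl i)) = miwaVar K i :=
  subst_X hasSubst_forgetVars _

theorem subst_forgetVars_miwaVar_inr {q : ℕ} (b : Fin q) :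
    subst (forgetVars K ι (Fin q)) (miwaVar K (Sum.inr b)) = 0 :=
  subst_X hasSubst_forgetVars _

theorem subst_forgetVars_miwaShift_map {q : ℕ} (ρ : TimeSeries K) (s : Finset ι) :
    subst (forgetVars K ι (Fin q)) (miwaShift ρ (s.map Function.Embedding.inl)) = miwaShift ρ s := by
  have harg : ((fun n => forgetVars K ι (Fin q) (Sum.inl n))
      + bracketSum (s.map Function.Embedding.inl) fun i => forgetVars K ι (Fin q) (Sum.inr i))
      = miwaX K ι + bracketSum s (miwaVar K) := by
    rw [bracketSum, bracketSum, sum_map]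
    rfl
  rw [subst_miwaShift hasSubst_forgetVars, harg, miwaShift]

theorem subst_forgetVars_miwaShift_insert {q : ℕ} (ρ : TimeSeries K) (i : ι) :
    subst (forgetVars K ι (Fin q)) (miwaShift ρ (insert (Sum.inl i)
      (univ.map Function.Embedding.inr))) = miwaShift ρ {i} := by
  have harg : ((fun n => forgetVars K ι (Fin q) (Sum.inl n))
      + bracketSum (insert (Sum.inl i) (univ.map Function.Embedding.inr))
        fun i => forgetVars K ι (Fin q) (Sum.inr i))
      = miwaX K ι + bracketSum {i} (miwaVar K) := by
    rw [bracketSum, bracketSum, sum_insert (by simp), sum_map, sum_singleton]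
    funext n
    simp [forgetVars, bracket]
  rw [subst_miwaShift hasSubst_forgetVars, harg, miwaShift]

/-- Setting the `q` variables of `B` to zero turns `∏ (α_i - α_b)` into `α_i ^ q`. -/
theorem ThreeTermEquation.sum_diffCofactor_eq_zero {τ : ℤ → TimeSeries K}
    (h : ThreeTermEquation τ) (hτ : ∀ l, τ l ≠ 0) {k q : ℕ} (hN : Fintype.card ι = k + 2 + q)
    {l l' : ℤ} (hl : l = l' + k) :
    ∑ i, diffCofactor (miwaVar K (ι := ι)) i * miwaVar K i ^ q
      * (miwaShift (τ l) (univ.erase i) * miwaShift (τ l') {i}) = 0 := by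
  let f : MiwaRing K (ι ⊕ Fin q) →+* MiwaRing K ι :=
    (substAlgHom (R := K) (hasSubst_forgetVars (K := K) (ι := ι) (κ := Fin q))).toRingHom
  have hf : ∀ F, f F = subst (forgetVars K ι (Fin q)) F := substAlgHom_apply _
  have key := congrArg f (h.sum_diffCofactor_mul_prod_eq_zero hτ hN hl)
  simp only [map_sum, map_mul, map_zero, map_diffCofactor, map_prod, map_sub] at key
  simpa only [hf, subst_forgetVars_miwaVar_inl, subst_forgetVars_miwaVar_inr, sub_zero,
    prod_const, card_univ, Fintype.card_fin, subst_forgetVars_miwaShift_map,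
    subst_forgetVars_miwaShift_insert] using key

theorem ThreeTermEquation.mkpHierarchy {τ : ℤ → TimeSeries K} (h : ThreeTermEquation τ)
    (hτ : ∀ l, τ l ≠ 0) : MKPHierarchy τ := by
  intro l l' hl
  apply eq_zero_of_subst_miwaArg
  intro N
  -- The residue formula needs at least `k + 2` variables, so `k + 2` extra ones are adjoined, with
  -- `q = N`, and set to zero afterwards.
  have hN : Fintype.card (Fin N ⊕ Fin ((l - l').toNat + 2)) = (l - l').toNat + 2 + N := by
    simp [add_comm]
  have h1 := diffProd_mul_subst_residue hN (τ l) (τ l')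
  rw [h.sum_diffCofactor_eq_zero hτ hN (by omega)] at h1
  rw [← subst_forgetVars_miwaArg (κ := Fin ((l - l').toNat + 2)),
    (mul_eq_zero.1 h1).resolve_left (diffProd_ne_zero miwaVar_injective),
    ← coe_substAlgHom (R := K) hasSubst_forgetVars, map_zero]

theorem MKPHierarchy.threeTermEquation {τ : ℤ → TimeSeries K} (h : MKPHierarchy τ) :
    ThreeTermEquation τ := by
  intro l
  have h0 := h (l + 1) l (by omega)
  rw [show (l + 1 - l).toNat = 1 by omega] at h0
  have h1 := diffProd_mul_subst_residue (ι := Fin 3) (k := 1) (q := 0) (by simp) (τ (l + 1)) (τ l)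
  rw [h0, ← coe_substAlgHom (R := K) hasSubst_miwaArg, map_zero, mul_zero] at h1
  have e1 : ∀ (ρ : TimeSeries K) (i : Fin 3),
      miwaShift ρ {i} = evalAt ρ (xvar + bracket (alpha i : ThreeTermRing K)) := by
    intro ρ i
    rw [miwaShift, bracketSum, sum_singleton]
    rfl
  have e2 : ∀ (ρ : TimeSeries K) (i j : Fin 3), i ≠ j → miwaShift ρ {i, j}
      = evalAt ρ (xvar + bracket (alpha i : ThreeTermRing K) + bracket (alpha j)) := by
    intro ρ i j hij
    rw [miwaShift, bracketSum, sum_pair hij, ← add_assoc]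
    rfl
  have u0 : (univ : Finset (Fin 3)).erase 0 = {1, 2} := by decide
  have u1 : (univ : Finset (Fin 3)).erase 1 = {0, 2} := by decide
  have u2 : (univ : Finset (Fin 3)).erase 2 = {0, 1} := by decide
  rw [Fin.sum_univ_three] at h1
  simp only [diffCofactor, u0, u1, u2, prod_pair (show (1 : Fin 3) ≠ 2 by decide),
    prod_pair (show (0 : Fin 3) ≠ 2 by decide), prod_pair (show (0 : Fin 3) ≠ 1 by decide),
    e2 _ 1 2 (by decide), e2 _ 0 2 (by decide), e2 _ 0 1 (by decide), e1, pow_zero] at h1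
  have hne : ∀ i j : Fin 3, i ≠ j → miwaVar K i - miwaVar K j ≠ 0 := fun i j hij =>
    sub_ne_zero.2 (miwaVar_injective.ne hij)
  -- Up to a common sign, the cofactors are this Vandermonde product times the signed differences in
  -- the three term equation.
  have hD := mul_ne_zero (mul_ne_zero (hne 0 1 (by decide)) (hne 0 2 (by decide)))
    (hne 1 2 (by decide))
  refine (mul_eq_zero.1 (?_ : (miwaVar K (0 : Fin 3) - miwaVar K 1) * (miwaVar K 0 - miwaVar K 2)
    * (miwaVar K 1 - miwaVar K 2) * _ = 0)).resolve_left hD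
  have ev : ∀ i : Fin 3, (alpha i : ThreeTermRing K) = miwaVar K i := fun _ => rfl
  simp only [ev] at h1 ⊢
  linear_combination h1

end Equivalence

end MKP

end

theorem theorem2 {K : Type*} [Field K] [CharZero K] (τ : ℤ → MKP.TimeSeries K)
    (hτ : ∀ l, τ l ≠ 0) :
    MKP.ThreeTermEquation τ ↔ MKP.MKPHierarchy τ :=
  ⟨fun h => h.mkpHierarchy hτ, fun h => h.threeTermEquation⟩
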